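/- Let \(\Pi_\infty\) be the improper anisotropic Poisson line process in \(\mathbb{R}^2\): non-vertical lines are parametrized by their heights \(y_-,y_+\) on \(x=-1\), \(x=+1\), and \(\Pi_\infty\) is the Poisson process of lines with intensity measure \(\tfrac14\,dy_-\,dy_+\). Let \(\Pi_{\infty,+}\) be the set of lines of \(\Pi_\infty\) which have positive slope and meet the negative \(x\)-axis, and let \[ \Gamma(s)=\inf\{\text{height of }\ell\text{ at }x=s:\ \ell\in\Pi_{\infty,+}\},\qquad 0<s\le 1 . \] Let \(\Gamma'\) denote the left-hand derivative of \(\Gamma\). Let \(S_0=1\) and, for \(n\ge 0\), let \(S_{n+1}\) be the largest \(s\in(0,S_n)\) at which \(\Gamma\) changes slope (the supremum of the \(s\in(0,S_n)\) at which \(\Gamma\) is not differentiable). Let \(Y_n=\Gamma(S_n)-S_n\Gamma'(S_n)\) be the intercept on the \(y\)-axis of the \(n\)-th line composing \(\Gamma\). Then almost surely \(1=S_0>S_1>S_2>\dots>0\) and \(Y_n>0\) for all \(n\), and there are random variables \(U_1,U_2,\dots\), independent of each other and of \((\Gamma(1),\Gamma'(1))\), each uniformly distributed on \([0,1]\), such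 that almost surely, for all \(n\ge 0\), \[ \Gamma'(S_{n+1})=\Gamma'(S_n)+\frac{Y_n}{S_{n+1}}\sqrt{U_{n+1}} \qquad\text{and}\qquad Y_{n+1}=Y_n\bigl(1-\sqrt{U_{n+1}}\bigr)=Y_0\prod_{m=1}^{n+1}\bigl(1-\sqrt{U_m}\bigr). \] Moreover, after modification of the \(Y_n\) on null sets, \((3^nY_n)_{n\ge0}\) is a (non-negative) martingale with respect to the natural filtration of \((Y_n)\). Finally \(\limsup_{n\to\infty}3^nY_n\) is almost surely equal to a finite non-negative random variable, and almost surely \(Y_n\to0\) geometrically fast: there is a finite random \(C\) with \(|Y_n|\le C\,3^{-n}\) for all \(n\ge 0\). -/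

import Mathlib

open MeasureTheory ProbabilityTheory Filter

noncomputable section

namespace PoissonCity

/-- A random set of points is a Poisson point process with (diffuse) intensity measure `ν` if
counts on measurable sets are random variables, the count on a set of finite intensity is Poisson
distributed with that mean, and counts on disjoint sets are independent. -/
structure IsPoissonProcess {Ω X : Type*} [MeasurableSpace Ω] [MeasurableSpace X]
    (P : Ω → Set X) (ν : Measure X) (μ : Measure Ω) : Prop where
  measurable_count : ∀ A : Set X, MeasurableSet A → Measurable fun ω => (P ω ∩ A).encard
  count_law : ∀ A : Set X, MeasurableSet A → ν A ≠ ⊤ →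
    μ.map (fun ω => (P ω ∩ A).encard) =
      (poissonMeasure (ν A).toNNReal).map (fun k : ℕ => (k : ℕ∞))
  indep_counts : ∀ (k : ℕ) (A : Fin k → Set X), (∀ i, MeasurableSet (A i)) →
    (∀ i j, i ≠ j → Disjoint (A i) (A j)) →
      iIndepFun (fun i ω => (P ω ∩ A i).encard) μ

/-- A non-vertical line in the plane, coded by its heights `(y₋, y₊)` on `x = -1` and `x = 1`. -/
abbrev Line := ℝ × ℝ

/-- Height of the line above the abscissa `x`. -/
def height (l : Line) (x : ℝ) : ℝ := ((1 - x) * l.1 + (1 + x) * l.2) / 2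

/-- Slope of the line. -/
def slope (l : Line) : ℝ := (l.2 - l.1) / 2

/-- The intensity measure `dy₋ dy₊ / 4` of the improper anisotropic Poisson line process. -/
def lineIntensity : Measure Line := (4⁻¹ : ENNReal) • (volume : Measure (ℝ × ℝ))

/-- The lines of positive slope that meet the negative `x`-axis. -/
def plusLines (L : Set Line) : Set Line :=
  {l | l ∈ L ∧ 0 < slope l ∧ ∃ x < 0, height l x = 0}

/-- The (right-hand) seminal curve: lower envelope of the lines in `plusLines L`. -/
def seminal (L : Set Line) (s : ℝ) : ℝ := sInf ((fun l => height l s) '' plusLines L)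

/-- The left-continuous slope of the seminal curve, i.e. its left-hand derivative. -/
def seminalSlope (L : Set Line) (s : ℝ) : ℝ := derivWithin (seminal L) (Set.Iic s) s

/-- `changeTime L 0 = 1`, and `changeTime L (n + 1)` is the last abscissa in
`(0, changeTime L n)` at which the seminal curve changes slope. -/
def changeTime (L : Set Line) : ℕ → ℝ
  | 0 => 1
  | n + 1 => sSup {s | 0 < s ∧ s < changeTime L n ∧ ¬ DifferentiableAt ℝ (seminal L) s}

/-- Intercept on the `y`-axis of the `n`-th line composing the seminal curve. -/
def yIntercept (L : Set Line) (n : ℕ) : ℝ :=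
  seminal L (changeTime L n) - changeTime L n * seminalSlope L (changeTime L n)

end PoissonCity

end

/-!
A line with intercept `b` on the `y`-axis and slope `a` is coded by the point `(b, a)`. In these
coordinates the lines form a Poisson process of intensity `1/2` times Lebesgue measure, and the
lines entering the seminal curve are the points of the open positive quadrant. The height at
abscissa `s` is `b + a * s`, so the lines composing the curve from `s = 1` down to `s = 0` are
successive vertices `x 0, x 1, ...` of the lower convex hull of these points. The supporting line
with normal `(t, 1)`, `t = 1 / s`, pivots around `x n` until it meets `x (n + 1)`; the value of `t`
at that moment is `hitTime x (n + 1)`, the inverse of the change time `S (n + 1)`.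

Probabilistically, the line pivoting around a vertex of intercept `b` sweeps a triangle of mass
`b ^ 2 / 4 * (hitTime x (n + 1) - hitTime x n)`, and the next vertex is size-biased on the swept
segment, because the element of mass at distance fraction `u` from the pivot is proportional to
`u du dt`. Hence `u ^ 2` is uniform and independent of the past; it is `areaFraction`, and
`b_{n+1} = b_n * (1 - u)`.

The rigorous form of this goes through the joint density of the first `n + 1` vertices, which is
`(1 / 2) ^ (n + 1) * exp (- mass of the swept region)`. That the law of the vertices is at most the
measure `pathMeasure n` with this density follows on small cubes by counting: if every vertex lies
in its own small cube then each cube contains a point of the process, and a region close to the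
swept one contains none (`eventually_measure_closedBall_le`). The Besicovitch covering theorem
extends the inequality to all sets (`measure_path_le`). Iterated integration shows that
`pathMeasure n` is a probability measure under which the area fractions are uniform and independent
of each other and of the first vertex (`pathMeasure_fractions`). Two probability measures of which
one dominates the other are equal; as the inequality is one between outer measures, it also yields
the measurability of the vertices (`nullMeasurable_of_measure_preimage_le`).

The martingale property is `E (1 - √U) = 1 / 3`, and the convergence of nonnegative martingales
gives the limit and the geometric bound.
-/

noncomputable section

namespace PoissonCity

open scoped Topology ENNReal

/-! ### The chain of vertices of the lower convex hull -/

/-- For vertices `x n = (b, a)`, the inverse abscissa `t = 1 / s` at which the lines `x n` and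
`x (n + 1)` have the same height; the chain starts from `t = 1`, that is `s = 1`. -/
def hitTime (x : ℕ → ℝ × ℝ) : ℕ → ℝ
  | 0 => 1
  | n + 1 => ((x (n + 1)).2 - (x n).2) / ((x n).1 - (x (n + 1)).1)

/-- The region of the quadrant swept by the supporting line before it meets the `n`-th vertex: for
`n = 0` the triangle below the line through `x 0`, afterwards the triangle with apex `x n` swept
while the line pivots from `hitTime x n` to `hitTime x (n + 1)`. -/
def sweep (x : ℕ → ℝ × ℝ) : ℕ → Set (ℝ × ℝ)
  | 0 => {z | 0 < z.1 ∧ 0 < z.2 ∧ z.1 + z.2 < (x 0).1 + (x 0).2}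
  | n + 1 => {z | 0 < z.1 ∧ z.1 < (x n).1 ∧ (x n).2 + hitTime x n * ((x n).1 - z.1) < z.2 ∧
      z.2 < (x n).2 + hitTime x (n + 1) * ((x n).1 - z.1)}

/-- The first `n + 1` terms of `x` can be successive vertices of a lower convex hull. Hitting times
are required to increase strictly, so aligned points are skipped. -/
def Admissible (x : ℕ → ℝ × ℝ) (n : ℕ) : Prop :=
  0 < (x 0).1 ∧ 0 < (x 0).2 ∧ ∀ i < n, 0 < (x (i + 1)).1 ∧ (x (i + 1)).1 < (x i).1 ∧
    hitTime x i < hitTime x (i + 1)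

/-- `x` lists the vertices, in the order of discovery, of the lower convex hull of the points of `P`
in the positive quadrant. -/
structure IsHullChain (P : Set (ℝ × ℝ)) (x : ℕ → ℝ × ℝ) : Prop where
  mem : ∀ n, x n ∈ P
  admissible : ∀ n, Admissible x n
  disjoint : ∀ n, Disjoint P (sweep x n)
  support : ∀ n, ∀ z ∈ P, 0 < z.1 → 0 < z.2 →
    hitTime x n * (x n).1 + (x n).2 ≤ hitTime x n * z.1 + z.2

theorem hitTime_mul (x : ℕ → ℝ × ℝ) (n : ℕ) (h : (x (n + 1)).1 < (x n).1) :
    hitTime x (n + 1) * ((x n).1 - (x (n + 1)).1) = (x (n + 1)).2 - (x n).2 := by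
  rw [hitTime]
  exact div_mul_cancel₀ _ (sub_pos.2 h).ne'

/-- `p` is the vertex reached at inverse abscissa `t`: the line with normal `(t, 1)` through `p`
supports the points of `P` in the quadrant, and among the points on it `p` has the largest slope. -/
structure IsVertex (P : Set (ℝ × ℝ)) (p : ℝ × ℝ) (t : ℝ) : Prop where
  mem : p ∈ P
  fst_pos : 0 < p.1
  snd_pos : 0 < p.2
  one_le : 1 ≤ t
  support : ∀ z ∈ P, 0 < z.1 → 0 < z.2 → t * p.1 + p.2 ≤ t * z.1 + z.2
  last : ∀ z ∈ P, 0 < z.1 → 0 < z.2 → t * p.1 + p.2 = t * z.1 + z.2 → z.2 ≤ p.2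

/-- A function with finite sublevel sets attains its minimum, and ties can be broken by maximising
another function. -/
theorem exists_lex_min {α : Type*} {N : Set α} {f g : α → ℝ} (hN : N.Nonempty)
    (hfin : ∀ c, {z ∈ N | f z ≤ c}.Finite) :
    ∃ p ∈ N, (∀ z ∈ N, f p ≤ f z) ∧ ∀ z ∈ N, f p = f z → g z ≤ g p := by
  obtain ⟨z₀, hz₀⟩ := hN
  obtain ⟨m, ⟨hmN, _⟩, hm⟩ := Set.exists_min_image _ f (hfin (f z₀)) ⟨z₀, hz₀, le_rfl⟩
  have hm' : ∀ z ∈ N, f m ≤ f z := fun z hz => by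
    rcases le_total (f z) (f z₀) with h | h
    · exact hm z ⟨hz, h⟩
    · exact (hm z₀ ⟨hz₀, le_rfl⟩).trans h
  obtain ⟨p, ⟨hpN, hpm⟩, hp⟩ := Set.exists_max_image _ g (hfin (f m)) ⟨m, hmN, le_rfl⟩
  exact ⟨p, hpN, fun z hz => hpm.trans (hm' z hz), fun z hz h => hp z ⟨hz, h ▸ hpm⟩⟩

theorem exists_first_vertex {P : Set (ℝ × ℝ)}
    (hfin : ∀ c : ℝ, {z | z ∈ P ∧ 0 < z.1 ∧ 0 < z.2 ∧ z.1 + z.2 ≤ c}.Finite)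
    (hne : ∀ c : ℝ, 0 < c → ∃ z ∈ P, 0 < z.1 ∧ z.1 < c ∧ 0 < z.2) :
    ∃ p, IsVertex P p 1 := by
  obtain ⟨z, hz, h1, -, h2⟩ := hne 1 one_pos
  obtain ⟨p, ⟨hpP, hp1, hp2⟩, hmin, hlast⟩ := exists_lex_min
    (N := {z | z ∈ P ∧ 0 < z.1 ∧ 0 < z.2}) (f := fun z => z.1 + z.2) (g := fun z => z.2)
    ⟨z, hz, h1, h2⟩ (fun c => (hfin c).subset fun w hw => ⟨hw.1.1, hw.1.2.1, hw.1.2.2, hw.2⟩)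
  refine ⟨p, hpP, hp1, hp2, le_rfl, fun w hw h1 h2 => ?_, fun w hw h1 h2 h => ?_⟩
  · simpa using hmin w ⟨hw, h1, h2⟩
  · exact hlast w ⟨hw, h1, h2⟩ (by simpa using h)

/-- The line pivoting around a vertex meets a next one: the first point of smaller intercept to be
hit, and the furthest one if several are hit together. -/
theorem IsVertex.exists_next {P : Set (ℝ × ℝ)} {p : ℝ × ℝ} {t : ℝ} (hp : IsVertex P p t)
    (hfin : ∀ c : ℝ, {z | z ∈ P ∧ 0 < z.1 ∧ 0 < z.2 ∧ z.1 + z.2 ≤ c}.Finite)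
    (hne : ∀ c : ℝ, 0 < c → ∃ z ∈ P, 0 < z.1 ∧ z.1 < c ∧ 0 < z.2) :
    ∃ q, IsVertex P q ((q.2 - p.2) / (p.1 - q.1)) ∧ q.1 < p.1 ∧
      t < (q.2 - p.2) / (p.1 - q.1) := by
  have ht := hp.one_le
  -- a point of smaller intercept lies strictly above the current line, by the tie-breaking rule
  have key : ∀ z ∈ P, 0 < z.1 → 0 < z.2 → z.1 < p.1 → t < (z.2 - p.2) / (p.1 - z.1) := by
    intro z hz h1 h2 h3
    rw [lt_div_iff₀ (sub_pos.2 h3)]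
    have h4 := hp.support z hz h1 h2
    rcases h4.lt_or_eq with h5 | h5
    · linarith
    · have := hp.last z hz h1 h2 h5
      nlinarith
  obtain ⟨z, hz, h1, h3, h2⟩ := hne p.1 hp.fst_pos
  obtain ⟨q, ⟨hqP, hq1, hq2, hq3⟩, hmin, hlast⟩ := exists_lex_min
    (N := {z | z ∈ P ∧ 0 < z.1 ∧ 0 < z.2 ∧ z.1 < p.1})
    (f := fun z => (z.2 - p.2) / (p.1 - z.1)) (g := fun z => z.2)
    ⟨z, hz, h1, h2, h3⟩ (fun c => (hfin (c * p.1 + p.2)).subset fun w hw => by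
      obtain ⟨⟨hw, w1, w2, w3⟩, h⟩ := hw
      have h6 := key w hw w1 w2 w3
      refine ⟨hw, w1, w2, ?_⟩
      have hc : 1 ≤ c := by linarith [h]
      rw [div_le_iff₀ (sub_pos.2 w3)] at h
      nlinarith)
  have htq := key q hqP hq1 hq2 hq3
  refine ⟨q, ?_, hq3, htq⟩
  set τ := (q.2 - p.2) / (p.1 - q.1) with hτ
  have hτq : τ * (p.1 - q.1) = q.2 - p.2 := div_mul_cancel₀ _ (sub_pos.2 hq3).ne'
  refine ⟨hqP, hq1, hq2, ht.trans htq.le, fun z hz h1 h2 => ?_, fun z hz h1 h2 h => ?_⟩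
  · rcases lt_or_ge z.1 p.1 with h3 | h3
    · have := hmin z ⟨hz, h1, h2, h3⟩
      rw [le_div_iff₀ (sub_pos.2 h3)] at this
      linarith
    · have := hp.support z hz h1 h2
      nlinarith
  · rcases lt_or_ge z.1 p.1 with h3 | h3
    · refine hlast z ⟨hz, h1, h2, h3⟩ ?_
      rw [eq_div_iff (sub_pos.2 h3).ne']
      linarith
    · have := hp.support z hz h1 h2
      nlinarith

/-- Local finiteness makes the first points hit exist; points of arbitrarily small intercept keep
the chain from stopping. -/
theorem exists_isHullChain {P : Set (ℝ × ℝ)}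
    (hfin : ∀ c : ℝ, {z | z ∈ P ∧ 0 < z.1 ∧ 0 < z.2 ∧ z.1 + z.2 ≤ c}.Finite)
    (hne : ∀ c : ℝ, 0 < c → ∃ z ∈ P, 0 < z.1 ∧ z.1 < c ∧ 0 < z.2) :
    ∃ x, IsHullChain P x := by
  obtain ⟨p₀, hp₀⟩ := exists_first_vertex hfin hne
  choose! nxt hnxt using fun (q : (ℝ × ℝ) × ℝ) (hq : IsVertex P q.1 q.2) =>
    hq.exists_next hfin hne
  let c : ℕ → (ℝ × ℝ) × ℝ := fun n => Nat.rec (p₀, 1)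
    (fun _ q => (nxt q, ((nxt q).2 - q.1.2) / (q.1.1 - (nxt q).1))) n
  have hc : ∀ n, IsVertex P (c n).1 (c n).2 := by
    intro n
    induction n with
    | zero => exact hp₀
    | succ n ih => exact (hnxt _ ih).1
  set x : ℕ → ℝ × ℝ := fun n => (c n).1 with hx
  have htime : ∀ n, hitTime x n = (c n).2 := by
    intro n
    cases n with
    | zero => rfl
    | succ n => rfl
  have hsupp : ∀ n, ∀ z ∈ P, 0 < z.1 → 0 < z.2 →
      hitTime x n * (x n).1 + (x n).2 ≤ hitTime x n * z.1 + z.2 := by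
    intro n
    rw [htime]
    exact (hc n).support
  have hlt : ∀ n, (x (n + 1)).1 < (x n).1 := fun n => (hnxt _ (hc n)).2.1
  refine ⟨x, fun n => (hc n).mem, fun n => ⟨(hc 0).fst_pos, (hc 0).snd_pos, fun i _ =>
    ⟨(hc (i + 1)).fst_pos, hlt i, ?_⟩⟩, fun n => ?_, hsupp⟩
  · rw [htime, htime]
    exact (hnxt _ (hc i)).2.2
  · rw [Set.disjoint_left]
    intro z hz hzs
    cases n with
    | zero =>
      obtain ⟨h1, h2, h3⟩ := hzs
      have := hsupp 0 z hz h1 h2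
      simp only [hitTime] at this
      linarith
    | succ n =>
      obtain ⟨h1, h2, h3, h4⟩ := hzs
      have h5 : 1 ≤ hitTime x n := by rw [htime]; exact (hc n).one_le
      have h6 : 0 < (x n).2 := (hc n).snd_pos
      have h7 : 0 < z.2 := by nlinarith
      have := hsupp (n + 1) z hz h1 h7
      have := hitTime_mul x n (hlt n)
      nlinarith

namespace IsHullChain

variable {P : Set (ℝ × ℝ)} {x : ℕ → ℝ × ℝ}

theorem fst_pos (h : IsHullChain P x) (n : ℕ) : 0 < (x n).1 := by
  cases n with
  | zero => exact (h.admissible 0).1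
  | succ n => exact ((h.admissible (n + 1)).2.2 n n.lt_succ_self).1

theorem fst_lt (h : IsHullChain P x) (n : ℕ) : (x (n + 1)).1 < (x n).1 :=
  ((h.admissible (n + 1)).2.2 n n.lt_succ_self).2.1

theorem hitTime_lt (h : IsHullChain P x) (n : ℕ) : hitTime x n < hitTime x (n + 1) :=
  ((h.admissible (n + 1)).2.2 n n.lt_succ_self).2.2

theorem one_le_hitTime (h : IsHullChain P x) (n : ℕ) : 1 ≤ hitTime x n := by
  induction n with
  | zero => exact le_rfl
  | succ n ih => exact ih.trans (h.hitTime_lt n).le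

theorem snd_lt (h : IsHullChain P x) (n : ℕ) : (x n).2 < (x (n + 1)).2 := by
  have h1 := hitTime_mul x n (h.fst_lt n)
  have h2 := h.one_le_hitTime (n + 1)
  have h3 := h.fst_lt n
  nlinarith

theorem snd_pos (h : IsHullChain P x) (n : ℕ) : 0 < (x n).2 := by
  induction n with
  | zero => exact (h.admissible 0).2.1
  | succ n ih => exact ih.trans (h.snd_lt n)

/-- Between two change times the current line is the lowest one. The two supporting lines at the
ends of the interval have `x n` in common. -/
theorem support_of_mem_Icc (h : IsHullChain P x) {n : ℕ} {s : ℝ}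
    (hs : s ∈ Set.Icc (1 / hitTime x (n + 1)) (1 / hitTime x n)) {z : ℝ × ℝ} (hz : z ∈ P)
    (h1 : 0 < z.1) (h2 : 0 < z.2) : (x n).1 + (x n).2 * s ≤ z.1 + z.2 * s := by
  have t0 := h.one_le_hitTime n
  have t1 := h.one_le_hitTime (n + 1)
  have e0 := h.support n z hz h1 h2
  have e1 := h.support (n + 1) z hz h1 h2
  have e2 := hitTime_mul x n (h.fst_lt n)
  obtain ⟨hs1, hs2⟩ := hs
  rw [div_le_iff₀ (by linarith)] at hs1
  rw [le_div_iff₀ (by linarith)] at hs2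
  have hs0 : 0 < s := by
    by_contra hh
    have : s * hitTime x (n + 1) ≤ 0 := mul_nonpos_of_nonpos_of_nonneg (not_lt.1 hh) (by linarith)
    linarith
  rcases le_total (x n).2 z.2 with hh | hh
  · -- the line of larger slope is compared at the left endpoint
    have a1 : 0 ≤ (z.2 - (x n).2) * (s * hitTime x (n + 1) - 1) :=
      mul_nonneg (by linarith) (by linarith)
    have a2 : 0 ≤ hitTime x (n + 1) * ((z.1 + z.2 * s) - ((x n).1 + (x n).2 * s)) := by linarith
    have := nonneg_of_mul_nonneg_right a2 (by linarith)
    linarith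
  · have a1 : 0 ≤ ((x n).2 - z.2) * (1 - s * hitTime x n) :=
      mul_nonneg (by linarith) (by linarith)
    have a2 : 0 ≤ hitTime x n * ((z.1 + z.2 * s) - ((x n).1 + (x n).2 * s)) := by linarith
    have := nonneg_of_mul_nonneg_right a2 (by linarith)
    linarith

end IsHullChain

/-! ### The seminal curve along the chain -/

/-- The intercept on the `y`-axis and the slope of a line. -/
def toPlane (l : Line) : ℝ × ℝ := (height l 0, slope l)

theorem height_eq (l : Line) (s : ℝ) : height l s = (toPlane l).1 + (toPlane l).2 * s := by
  simp only [toPlane, height, slope]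
  ring

theorem mem_plusLines_iff (L : Set Line) (l : Line) :
    l ∈ plusLines L ↔ l ∈ L ∧ 0 < (toPlane l).1 ∧ 0 < (toPlane l).2 := by
  simp only [plusLines, Set.mem_ofPred_eq, height_eq l]
  refine and_congr_right fun _ => ⟨?_, ?_⟩
  · rintro ⟨h1, x, hx, h2⟩
    have h1' : 0 < (toPlane l).2 := h1
    exact ⟨by nlinarith, h1'⟩
  · rintro ⟨h1, h2⟩
    refine ⟨h2, -((toPlane l).1 / (toPlane l).2), by simpa using div_pos h1 h2, ?_⟩
    field_simp
    ring

namespace IsHullChain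

variable {L : Set Line} {x : ℕ → ℝ × ℝ}

theorem seminal_eq (h : IsHullChain (toPlane '' L) x) {n : ℕ} {s : ℝ}
    (hs : s ∈ Set.Icc (1 / hitTime x (n + 1)) (1 / hitTime x n)) :
    seminal L s = (x n).1 + (x n).2 * s := by
  refine IsLeast.csInf_eq ⟨?_, ?_⟩
  · obtain ⟨l, hl, hlx⟩ := h.mem n
    refine ⟨l, (mem_plusLines_iff L l).2 ⟨hl, ?_, ?_⟩, ?_⟩
    · rw [hlx]; exact h.fst_pos n
    · rw [hlx]; exact h.snd_pos n
    · simp only [height_eq, hlx]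
  · rintro _ ⟨l, hl, rfl⟩
    obtain ⟨hl, h1, h2⟩ := (mem_plusLines_iff L l).1 hl
    simp only [height_eq]
    exact h.support_of_mem_Icc hs ⟨l, hl, rfl⟩ h1 h2

theorem inv_hitTime_lt {P : Set (ℝ × ℝ)} (h : IsHullChain P x) (n : ℕ) :
    1 / hitTime x (n + 1) < 1 / hitTime x n :=
  one_div_lt_one_div_of_lt (zero_lt_one.trans_le (h.one_le_hitTime n)) (h.hitTime_lt n)

theorem inv_hitTime_pos {P : Set (ℝ × ℝ)} (h : IsHullChain P x) (n : ℕ) : 0 < 1 / hitTime x n :=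
  one_div_pos.2 (zero_lt_one.trans_le (h.one_le_hitTime n))

theorem hasDerivAt_line (b a s : ℝ) : HasDerivAt (fun y : ℝ => b + a * y) a s := by
  simpa using ((hasDerivAt_id s).const_mul a).const_add b

theorem hasDerivWithinAt_seminal (h : IsHullChain (toPlane '' L) x) {n : ℕ} {s : ℝ}
    (hs : s ∈ Set.Icc (1 / hitTime x (n + 1)) (1 / hitTime x n)) :
    HasDerivWithinAt (seminal L) (x n).2
      (Set.Icc (1 / hitTime x (n + 1)) (1 / hitTime x n)) s :=
  (hasDerivAt_line (x n).1 (x n).2 s).hasDerivWithinAt.congr_of_mem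
    (fun _ hy => h.seminal_eq hy) hs

theorem seminalSlope_eq (h : IsHullChain (toPlane '' L) x) (n : ℕ) :
    seminalSlope L (1 / hitTime x n) = (x n).2 := by
  have h1 : HasDerivWithinAt (seminal L) (x n).2 (Set.Iic (1 / hitTime x n)) (1 / hitTime x n) :=
    (h.hasDerivWithinAt_seminal
      (Set.right_mem_Icc.2 (h.inv_hitTime_lt n).le)).mono_of_mem_nhdsWithin
      (Icc_mem_nhdsLE (h.inv_hitTime_lt n))
  exact h1.derivWithin (uniqueDiffWithinAt_Iic _)

theorem not_differentiableAt (h : IsHullChain (toPlane '' L) x) (n : ℕ) :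
    ¬ DifferentiableAt ℝ (seminal L) (1 / hitTime x (n + 1)) := by
  intro hd
  have h1 := h.hasDerivWithinAt_seminal (Set.left_mem_Icc.2 (h.inv_hitTime_lt n).le)
  have h2 := h.hasDerivWithinAt_seminal (Set.right_mem_Icc.2 (h.inv_hitTime_lt (n + 1)).le)
  have u1 := ((uniqueDiffOn_Icc (h.inv_hitTime_lt n)) _
    (Set.left_mem_Icc.2 (h.inv_hitTime_lt n).le)).eq_deriv _ h1 hd.hasDerivAt.hasDerivWithinAt
  have u2 := ((uniqueDiffOn_Icc (h.inv_hitTime_lt (n + 1))) _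
    (Set.right_mem_Icc.2 (h.inv_hitTime_lt (n + 1)).le)).eq_deriv _ h2
      hd.hasDerivAt.hasDerivWithinAt
  exact (h.snd_lt n).ne (u1.trans u2.symm)

theorem differentiableAt (h : IsHullChain (toPlane '' L) x) {n : ℕ} {s : ℝ}
    (h1 : 1 / hitTime x (n + 1) < s) (h2 : s < 1 / hitTime x n) :
    DifferentiableAt ℝ (seminal L) s :=
  ((h.hasDerivWithinAt_seminal ⟨h1.le, h2.le⟩).hasDerivAt
    (Icc_mem_nhds h1 h2)).differentiableAt

theorem changeTime_eq (h : IsHullChain (toPlane '' L) x) (n : ℕ) :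
    changeTime L n = 1 / hitTime x n := by
  induction n with
  | zero => simp [changeTime, hitTime]
  | succ n ih =>
    rw [changeTime, ih]
    refine IsGreatest.csSup_eq ⟨⟨h.inv_hitTime_pos _, h.inv_hitTime_lt n,
      h.not_differentiableAt n⟩, ?_⟩
    rintro s ⟨-, hs, hd⟩
    exact not_lt.1 fun hlt => hd (h.differentiableAt hlt hs)

theorem seminal_changeTime (h : IsHullChain (toPlane '' L) x) (n : ℕ) :
    seminal L (changeTime L n) = (x n).1 + (x n).2 * changeTime L n := by
  rw [h.changeTime_eq]
  exact h.seminal_eq (Set.right_mem_Icc.2 (h.inv_hitTime_lt n).le)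

theorem seminalSlope_changeTime (h : IsHullChain (toPlane '' L) x) (n : ℕ) :
    seminalSlope L (changeTime L n) = (x n).2 := by
  rw [h.changeTime_eq, h.seminalSlope_eq]

theorem yIntercept_eq (h : IsHullChain (toPlane '' L) x) (n : ℕ) :
    yIntercept L n = (x n).1 := by
  rw [yIntercept, h.seminal_changeTime, h.seminalSlope_changeTime]
  ring

end IsHullChain

/-! ### The Poisson process in intercept-slope coordinates -/

/-- The image of `lineIntensity` in intercept-slope coordinates. -/
def halfVolume : Measure (ℝ × ℝ) := (2⁻¹ : ℝ≥0∞) • volume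

theorem halfVolume_apply (A : Set (ℝ × ℝ)) : halfVolume A = 2⁻¹ * volume A := rfl

theorem toPlane_injective : Function.Injective toPlane := by
  intro l m h
  simp only [toPlane, height, slope, Prod.mk.injEq] at h
  ext <;> linarith [h.1, h.2]

theorem measurable_toPlane : Measurable toPlane := by
  unfold toPlane height slope
  fun_prop

theorem lineIntensity_preimage {A : Set (ℝ × ℝ)} :
    lineIntensity (toPlane ⁻¹' A) = 2⁻¹ * volume A := by
  let f : ℝ × ℝ →ₗ[ℝ] ℝ × ℝ := ((1 / 2 : ℝ) • (LinearMap.fst ℝ ℝ ℝ + LinearMap.snd ℝ ℝ ℝ)).prod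
    ((1 / 2 : ℝ) • (LinearMap.snd ℝ ℝ ℝ - LinearMap.fst ℝ ℝ ℝ))
  have hf : toPlane = f := by
    funext l
    ext <;> simp [f, toPlane, height, slope] <;> ring
  have hdet : LinearMap.det f = 1 / 2 := by
    rw [← LinearMap.det_toMatrix (Module.Basis.finTwoProd ℝ), Matrix.det_fin_two]
    simp [LinearMap.toMatrix_apply, f]
    norm_num
  rw [hf, lineIntensity, Measure.smul_apply,
    Measure.addHaar_preimage_linearMap volume (by rw [hdet]; norm_num), hdet, smul_eq_mul,
    ← mul_assoc]
  congr 1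
  norm_num
  rw [← ENNReal.toReal_eq_toReal_iff' (by finiteness) (by finiteness)]
  norm_num

theorem isPoissonProcess_toPlane {Ω : Type*} [MeasurableSpace Ω] {μ : Measure Ω}
    {L : Ω → Set Line} (hL : IsPoissonProcess L lineIntensity μ) :
    IsPoissonProcess (fun ω => toPlane '' L ω) halfVolume μ := by
  have hcount : ∀ (ω : Ω) (A : Set (ℝ × ℝ)),
      (toPlane '' L ω ∩ A).encard = (L ω ∩ toPlane ⁻¹' A).encard := fun ω A => by
    rw [← Set.image_inter_preimage, toPlane_injective.encard_image]
  have hint : ∀ A : Set (ℝ × ℝ), halfVolume A = lineIntensity (toPlane ⁻¹' A) :=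
    fun A => lineIntensity_preimage.symm
  refine ⟨fun A hA => ?_, fun A hA h => ?_, fun k A hA hd => ?_⟩
  · simp only [hcount]
    exact hL.measurable_count _ (measurable_toPlane hA)
  · simp only [hcount, hint] at h ⊢
    exact hL.count_law _ (measurable_toPlane hA) h
  · simp only [hcount]
    exact hL.indep_counts k _ (fun i => measurable_toPlane (hA i))
      fun i j hij => (hd i j hij).preimage _

section Counts

variable {Ω X : Type*} [MeasurableSpace Ω] [MeasurableSpace X] {P : Ω → Set X} {ν : Measure X}
  {μ : Measure Ω}

theorem IsPoissonProcess.measure_inter_eq_empty (hP : IsPoissonProcess P ν μ) {A : Set X}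
    (hA : MeasurableSet A) (hν : ν A ≠ ⊤) :
    μ {ω | P ω ∩ A = ∅} = ENNReal.ofReal (Real.exp (-(ν A).toReal)) := by
  have h := congrArg (fun m : Measure ℕ∞ => m {0}) (hP.count_law A hA hν)
  rw [Measure.map_apply (hP.measurable_count A hA) (measurableSet_singleton _),
    Measure.map_apply (measurable_of_countable _) (measurableSet_singleton _)] at h
  have e1 : (fun ω => (P ω ∩ A).encard) ⁻¹' {0} = {ω | P ω ∩ A = ∅} := by
    ext ω; simp
  have e2 : (fun k : ℕ => (k : ℕ∞)) ⁻¹' {0} = {0} := by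
    ext k; simp
  rw [e1, e2, poissonMeasure_singleton] at h
  simpa [ENNReal.toReal] using h

theorem IsPoissonProcess.ae_finite (hP : IsPoissonProcess P ν μ) {A : Set X}
    (hA : MeasurableSet A) (hν : ν A ≠ ⊤) : ∀ᵐ ω ∂μ, (P ω ∩ A).Finite := by
  have h := congrArg (fun m : Measure ℕ∞ => m {⊤}) (hP.count_law A hA hν)
  rw [Measure.map_apply (hP.measurable_count A hA) (measurableSet_singleton _),
    Measure.map_apply (measurable_of_countable _) (measurableSet_singleton _)] at h
  have e2 : (fun k : ℕ => (k : ℕ∞)) ⁻¹' {⊤} = ∅ := by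
    ext k; simp
  rw [e2, measure_empty] at h
  rw [ae_iff]
  convert h using 2
  ext ω
  exact Set.encard_eq_top_iff.symm

theorem IsPoissonProcess.measure_inter_nonempty_le [IsProbabilityMeasure μ]
    (hP : IsPoissonProcess P ν μ) {A : Set X}
    (hA : MeasurableSet A) (hν : ν A ≠ ⊤) : μ {ω | (P ω ∩ A).Nonempty} ≤ ν A := by
  have hm : MeasurableSet {ω | P ω ∩ A = ∅} := by
    convert hP.measurable_count A hA (measurableSet_singleton 0) using 1
    ext ω; simp
  have e : {ω | (P ω ∩ A).Nonempty} = {ω | P ω ∩ A = ∅}ᶜ := by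
    ext ω; simp [Set.nonempty_iff_ne_empty]
  rw [e, prob_compl_eq_one_sub hm, hP.measure_inter_eq_empty hA hν, ← ENNReal.ofReal_one,
    ← ENNReal.ofReal_sub _ (Real.exp_pos _).le]
  refine ENNReal.ofReal_le_of_le_toReal ?_
  linarith [Real.add_one_le_exp (-(ν A).toReal)]

end Counts

/-! ### The mass of the swept region -/

theorem inv_two_eq_ofReal : (2⁻¹ : ℝ≥0∞) = ENNReal.ofReal (1 / 2) := by
  rw [one_div, ENNReal.ofReal_inv_of_pos two_pos]
  simp

theorem setIntegral_triangle {c : ℝ} (hc : 0 < c) (k : ℝ) :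
    ∫ b in Set.Ioo 0 c, k * (c - b) = k * (c ^ 2 / 2) := by
  rw [← integral_Ioc_eq_integral_Ioo, ← intervalIntegral.integral_of_le hc.le,
    intervalIntegral.integral_const_mul, intervalIntegral.integral_comp_sub_left (fun b => b)]
  simp

/-- The mass of a triangle with apex at first coordinate `c`, whose section at first coordinate `b`
has length `k * (c - b)`. -/
theorem halfVolume_triangle {c : ℝ} (hc : 0 < c) {f g : ℝ → ℝ} {k : ℝ} (hk : 0 ≤ k)
    (hf : Continuous f) (hg : Continuous g) (hfg : ∀ b, g b - f b = k * (c - b)) :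
    halfVolume {z | 0 < z.1 ∧ z.1 < c ∧ f z.1 < z.2 ∧ z.2 < g z.1} =
      ENNReal.ofReal (c ^ 2 / 4 * k) := by
  have e : {z : ℝ × ℝ | 0 < z.1 ∧ z.1 < c ∧ f z.1 < z.2 ∧ z.2 < g z.1} =
      regionBetween f g (Set.Ioo 0 c) := by
    ext z
    simp only [regionBetween, Set.mem_ofPred_eq, Set.mem_Ioo, and_assoc]
  have hfi : IntegrableOn f (Set.Ioo 0 c) :=
    (hf.integrableOn_Icc (a := 0) (b := c)).mono_set Set.Ioo_subset_Icc_self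
  have hgi : IntegrableOn g (Set.Ioo 0 c) :=
    (hg.integrableOn_Icc (a := 0) (b := c)).mono_set Set.Ioo_subset_Icc_self
  rw [halfVolume_apply, e, Measure.volume_eq_prod,
    volume_regionBetween_eq_integral hfi hgi measurableSet_Ioo ?_]
  · simp only [Pi.sub_apply, hfg]
    rw [setIntegral_triangle hc, inv_two_eq_ofReal, ← ENNReal.ofReal_mul (by norm_num)]
    congr 1
    ring
  · intro b hb
    have := hfg b
    nlinarith [hb.2]

/-- The mass of `sweep x n` for an admissible chain. -/
def rate (x : ℕ → ℝ × ℝ) : ℕ → ℝ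
  | 0 => ((x 0).1 + (x 0).2) ^ 2 / 4
  | n + 1 => (x n).1 ^ 2 / 4 * (hitTime x (n + 1) - hitTime x n)

theorem Admissible.fst_pos {x : ℕ → ℝ × ℝ} {n : ℕ} (h : Admissible x n) {i : ℕ} (hi : i ≤ n) :
    0 < (x i).1 := by
  cases i with
  | zero => exact h.1
  | succ i => exact (h.2.2 i hi).1

theorem halfVolume_sweep {x : ℕ → ℝ × ℝ} {n : ℕ} (h : Admissible x n) {i : ℕ} (hi : i ≤ n) :
    halfVolume (sweep x i) = ENNReal.ofReal (rate x i) := by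
  cases i with
  | zero =>
    rw [show rate x 0 = ((x 0).1 + (x 0).2) ^ 2 / 4 * 1 by simp [rate]]
    rw [← halfVolume_triangle (c := (x 0).1 + (x 0).2) (f := fun _ => 0)
      (g := fun b => (x 0).1 + (x 0).2 - b) (add_pos h.1 h.2.1) zero_le_one (by fun_prop)
      (by fun_prop) (fun b => by ring)]
    congr 1
    ext z
    simp only [sweep, Set.mem_ofPred_eq]
    constructor
    · rintro ⟨h1, h2, h3⟩
      exact ⟨h1, by linarith, h2, by linarith⟩
    · rintro ⟨h1, h2, h3, h4⟩
      exact ⟨h1, h3, by linarith⟩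
  | succ i =>
    exact halfVolume_triangle (c := (x i).1)
      (f := fun b => (x i).2 + hitTime x i * ((x i).1 - b))
      (g := fun b => (x i).2 + hitTime x (i + 1) * ((x i).1 - b)) (h.fst_pos (by omega))
      (sub_nonneg.2 (h.2.2 i hi).2.2.le) (by fun_prop) (by fun_prop) (fun b => by ring)

theorem isOpen_sweep (x : ℕ → ℝ × ℝ) (i : ℕ) : IsOpen (sweep x i) := by
  cases i with
  | zero =>
    refine IsOpen.and ?_ (IsOpen.and ?_ ?_)
    all_goals exact isOpen_lt (by fun_prop) (by fun_prop)
  | succ i =>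
    refine IsOpen.and ?_ (IsOpen.and ?_ (IsOpen.and ?_ ?_))
    all_goals exact isOpen_lt (by fun_prop) (by fun_prop)

theorem Admissible.below_of_mem_sweep {x : ℕ → ℝ × ℝ} {n : ℕ} (h : Admissible x n) {i : ℕ}
    (hi : i ≤ n) {z : ℝ × ℝ} (hz : z ∈ sweep x i) :
    hitTime x i * z.1 + z.2 < hitTime x i * (x i).1 + (x i).2 := by
  cases i with
  | zero => simpa [hitTime] using hz.2.2
  | succ i =>
    have := hitTime_mul x i (h.2.2 i hi).2.1
    linarith [hz.2.2.2]

/-- A point of a later swept triangle lies above all earlier supporting lines. -/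
theorem Admissible.above_of_mem_sweep {x : ℕ → ℝ × ℝ} {n : ℕ} (h : Admissible x n) {i : ℕ}
    (hi : i < n) {z : ℝ × ℝ} (hz : z ∈ sweep x (i + 1)) {j : ℕ} (hj : j ≤ i) :
    z.1 < (x j).1 ∧ hitTime x j * (x j).1 + (x j).2 < hitTime x j * z.1 + z.2 := by
  induction hj using Nat.decreasingInduction with
  | self => exact ⟨hz.2.1, by linarith [hz.2.2.1]⟩
  | of_succ j hj ih =>
    obtain ⟨-, h2, h3⟩ := h.2.2 j (by omega)
    have := hitTime_mul x j h2
    refine ⟨ih.1.trans h2, ?_⟩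
    nlinarith [ih.1, ih.2]

theorem Admissible.disjoint_sweep {x : ℕ → ℝ × ℝ} {n : ℕ} (h : Admissible x n) {i j : ℕ}
    (hi : i ≤ n) (hj : j < i) : Disjoint (sweep x i) (sweep x j) := by
  rw [Set.disjoint_left]
  intro z hz hz'
  obtain ⟨i, rfl⟩ : ∃ k, i = k + 1 := ⟨i - 1, by omega⟩
  have h1 := (h.above_of_mem_sweep hi hz (Nat.lt_succ_iff.1 hj)).2
  have h2 := h.below_of_mem_sweep (by omega : j ≤ n) hz'
  linarith

/-- The region swept up to the discovery of the `n`-th vertex. -/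
def swept (x : ℕ → ℝ × ℝ) (n : ℕ) : Set (ℝ × ℝ) := ⋃ i ∈ Finset.range (n + 1), sweep x i

/-- The mass of `swept x n` for an admissible chain. -/
def totalRate (x : ℕ → ℝ × ℝ) (n : ℕ) : ℝ := ∑ i ∈ Finset.range (n + 1), rate x i

theorem Admissible.rate_nonneg {x : ℕ → ℝ × ℝ} {n : ℕ} (h : Admissible x n) {i : ℕ}
    (hi : i ≤ n) : 0 ≤ rate x i := by
  cases i with
  | zero => exact div_nonneg (sq_nonneg _) (by norm_num)
  | succ i =>
    exact mul_nonneg (div_nonneg (sq_nonneg _) (by norm_num))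
      (sub_nonneg.2 (h.2.2 i hi).2.2.le)

theorem halfVolume_swept {x : ℕ → ℝ × ℝ} {n : ℕ} (h : Admissible x n) :
    halfVolume (swept x n) = ENNReal.ofReal (totalRate x n) := by
  rw [swept, measure_biUnion_finset, totalRate, ENNReal.ofReal_sum_of_nonneg]
  · exact Finset.sum_congr rfl fun i hi => halfVolume_sweep h (by simpa [Nat.lt_succ_iff] using hi)
  · exact fun i hi => h.rate_nonneg (by simpa [Nat.lt_succ_iff] using hi)
  · intro i hi j hj hij
    simp only [Finset.coe_range, Set.mem_Iio] at hi hj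
    rcases lt_or_gt_of_ne hij with h' | h'
    · exact (h.disjoint_sweep (by omega) h').symm
    · exact h.disjoint_sweep (by omega) h'
  · exact fun i _ => (isOpen_sweep x i).measurableSet

/-! ### Finite tuples of vertices and continuity -/

/-- A tuple of `n + 1` points as a sequence, with the value `0` beyond its length. -/
def extend {n : ℕ} (v : Fin (n + 1) → ℝ × ℝ) (i : ℕ) : ℝ × ℝ :=
  if h : i < n + 1 then v ⟨i, h⟩ else 0

@[fun_prop]
theorem continuous_extend {n : ℕ} (i : ℕ) :
    Continuous fun v : Fin (n + 1) → ℝ × ℝ => extend v i := by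
  unfold extend
  split_ifs <;> fun_prop

section Congr

variable {x y : ℕ → ℝ × ℝ} {n : ℕ}

theorem hitTime_congr (h : ∀ i ≤ n, x i = y i) : hitTime x n = hitTime y n := by
  cases n with
  | zero => rfl
  | succ n => simp only [hitTime, h n (by omega), h (n + 1) le_rfl]

theorem sweep_congr (h : ∀ i ≤ n, x i = y i) : sweep x n = sweep y n := by
  cases n with
  | zero => simp only [sweep, h 0 le_rfl]
  | succ n =>
    simp only [sweep, h n (by omega), hitTime_congr h,
      hitTime_congr fun i (hi : i ≤ n) => h i (by omega)]

theorem rate_congr (h : ∀ i ≤ n, x i = y i) : rate x n = rate y n := by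
  cases n with
  | zero => simp only [rate, h 0 le_rfl]
  | succ n =>
    simp only [rate, h n (by omega), hitTime_congr h,
      hitTime_congr fun i (hi : i ≤ n) => h i (by omega)]

theorem totalRate_congr (h : ∀ i ≤ n, x i = y i) : totalRate x n = totalRate y n :=
  Finset.sum_congr rfl fun i hi => rate_congr fun j hj => h j (by
    have := Finset.mem_range.1 hi
    omega)

theorem swept_congr (h : ∀ i ≤ n, x i = y i) : swept x n = swept y n :=
  Set.iUnion₂_congr fun i hi => sweep_congr fun j hj => h j (by
    have := Finset.mem_range.1 hi
    omega)

theorem Admissible.congr (hx : Admissible x n) (h : ∀ i ≤ n, x i = y i) : Admissible y n := by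
  obtain ⟨h1, h2, h3⟩ := hx
  refine ⟨h 0 (by omega) ▸ h1, h 0 (by omega) ▸ h2, fun i hi => ?_⟩
  rw [← h i (by omega), ← h (i + 1) (by omega),
    ← hitTime_congr fun j (hj : j ≤ i) => h j (by omega),
    ← hitTime_congr fun j (hj : j ≤ i + 1) => h j (by omega)]
  exact h3 i hi

theorem admissible_congr (h : ∀ i ≤ n, x i = y i) : Admissible x n ↔ Admissible y n :=
  ⟨fun hx => hx.congr h, fun hy => hy.congr fun i hi => (h i hi).symm⟩

end Congr

theorem extend_restrict (x : ℕ → ℝ × ℝ) {n i : ℕ} (hi : i ≤ n) :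
    extend (fun j : Fin (n + 1) => x j) i = x i := by
  simp [extend, Nat.lt_succ_iff.2 hi]

theorem continuousAt_hitTime {n : ℕ} {v : Fin (n + 1) → ℝ × ℝ} (h : Admissible (extend v) n)
    {i : ℕ} (hi : i ≤ n) :
    ContinuousAt (fun w : Fin (n + 1) → ℝ × ℝ => hitTime (extend w) i) v := by
  cases i with
  | zero => exact continuousAt_const
  | succ i =>
    exact ContinuousAt.div (by fun_prop) (by fun_prop) (sub_pos.2 (h.2.2 i hi).2.1).ne'

theorem continuousAt_totalRate {n : ℕ} {v : Fin (n + 1) → ℝ × ℝ} (h : Admissible (extend v) n) :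
    ContinuousAt (fun w : Fin (n + 1) → ℝ × ℝ => totalRate (extend w) n) v := by
  unfold totalRate
  refine tendsto_finsetSum _ fun i hi => ?_
  have hi := Finset.mem_range.1 hi
  cases i with
  | zero => exact Continuous.continuousAt (by unfold rate; fun_prop)
  | succ i =>
    exact ContinuousAt.mul (by fun_prop)
      ((continuousAt_hitTime h (by omega)).sub (continuousAt_hitTime h (by omega)))

theorem eventually_admissible {n : ℕ} {v : Fin (n + 1) → ℝ × ℝ} (h : Admissible (extend v) n) :
    ∀ᶠ w in 𝓝 v, Admissible (extend w) n := by
  have e : ∀ {f g : (Fin (n + 1) → ℝ × ℝ) → ℝ}, ContinuousAt f v → ContinuousAt g v →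
      f v < g v → ∀ᶠ w in 𝓝 v, f w < g w := fun hf hg hfg => hf.eventually_lt hg hfg
  have h3 : ∀ᶠ w in 𝓝 v, ∀ i ∈ Finset.range n, 0 < (extend w (i + 1)).1 ∧
      (extend w (i + 1)).1 < (extend w i).1 ∧
      hitTime (extend w) i < hitTime (extend w) (i + 1) := by
    rw [Filter.eventually_all_finset]
    intro i hi
    have hi := Finset.mem_range.1 hi
    obtain ⟨a1, a2, a3⟩ := h.2.2 i hi
    exact (e (by fun_prop) (by fun_prop) a1).and ((e (by fun_prop) (by fun_prop) a2).and
      (e (continuousAt_hitTime h (by omega)) (continuousAt_hitTime h (by omega)) a3))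
  filter_upwards [
    e (f := fun _ => 0) (g := fun w => (extend w 0).1) (by fun_prop) (by fun_prop) h.1,
    e (f := fun _ => 0) (g := fun w => (extend w 0).2) (by fun_prop) (by fun_prop) h.2.1, h3]
    with w h1 h2 h3
  exact ⟨h1, h2, fun i hi => h3 i (Finset.mem_range.2 hi)⟩

theorem eventually_mem_swept {n : ℕ} {v : Fin (n + 1) → ℝ × ℝ} (h : Admissible (extend v) n)
    {z : ℝ × ℝ} (hz : z ∈ swept (extend v) n) :
    ∀ᶠ q : (Fin (n + 1) → ℝ × ℝ) × (ℝ × ℝ) in 𝓝 (v, z), q.2 ∈ swept (extend q.1) n := by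
  simp only [swept, Set.mem_iUnion] at hz ⊢
  obtain ⟨i, hi, hz⟩ := hz
  have hi' := Finset.mem_range.1 hi
  have e : ∀ {f g : (Fin (n + 1) → ℝ × ℝ) × (ℝ × ℝ) → ℝ}, ContinuousAt f (v, z) →
      ContinuousAt g (v, z) → f (v, z) < g (v, z) → ∀ᶠ w in 𝓝 (v, z), f w < g w :=
    fun hf hg hfg => hf.eventually_lt hg hfg
  have hc : ∀ j ≤ n, ContinuousAt (fun q : (Fin (n + 1) → ℝ × ℝ) × (ℝ × ℝ) =>
      hitTime (extend q.1) j) (v, z) := fun j hj =>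
    ContinuousAt.comp (f := fun q : (Fin (n + 1) → ℝ × ℝ) × (ℝ × ℝ) => q.1)
      (g := fun w => hitTime (extend w) j) (continuousAt_hitTime h hj) continuousAt_fst
  have hx : ∀ j, Continuous (fun q : (Fin (n + 1) → ℝ × ℝ) × (ℝ × ℝ) => extend q.1 j) :=
    fun j => (continuous_extend j).comp continuous_fst
  suffices H : ∀ᶠ q : (Fin (n + 1) → ℝ × ℝ) × (ℝ × ℝ) in 𝓝 (v, z), q.2 ∈ sweep (extend q.1) i from
    H.mono fun q hq => ⟨i, hi, hq⟩
  cases i with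
  | zero =>
    obtain ⟨h1, h2, h3⟩ := hz
    have hx0 := hx 0
    exact (e (f := fun _ => 0) (g := fun q => q.2.1) (by fun_prop) (by fun_prop) h1).and
      ((e (f := fun _ => 0) (g := fun q => q.2.2) (by fun_prop) (by fun_prop) h2).and
      (e (f := fun q => q.2.1 + q.2.2) (g := fun q => (extend q.1 0).1 + (extend q.1 0).2)
        (by fun_prop) (by fun_prop) h3))
  | succ i =>
    obtain ⟨h1, h2, h3, h4⟩ := hz
    have hxi := hx i
    have c1 := hc i (by omega)
    have c2 := hc (i + 1) (by omega)
    exact (e (f := fun _ => 0) (g := fun q => q.2.1) (by fun_prop) (by fun_prop) h1).and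
      ((e (f := fun q => q.2.1) (g := fun q => (extend q.1 i).1) (by fun_prop) (by fun_prop) h2).and
      ((e (f := fun q => (extend q.1 i).2 + hitTime (extend q.1) i * ((extend q.1 i).1 - q.2.1))
        (g := fun q => q.2.2) (by fun_prop) (by fun_prop) h3).and
      (e (f := fun q => q.2.2)
        (g := fun q => (extend q.1 i).2 + hitTime (extend q.1) (i + 1) * ((extend q.1 i).1 - q.2.1))
        (by fun_prop) (by fun_prop) h4)))

/-- The swept region of `v` is approximated from inside in mass by a set `K` which the swept
regions of all nearby tuples contain, and which avoids the neighbourhoods of the vertices. -/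
theorem exists_inner_region {n : ℕ} {v : Fin (n + 1) → ℝ × ℝ} (h : Admissible (extend v) n)
    {ε : ℝ} (hε : 0 < ε) :
    ∃ δ > 0, ∃ K : Set (ℝ × ℝ), MeasurableSet K ∧ halfVolume K ≠ ⊤ ∧
      totalRate (extend v) n - ε ≤ (halfVolume K).toReal ∧
      (∀ w ∈ Metric.closedBall v δ, K ⊆ swept (extend w) n) ∧
      ∀ i, Disjoint K (Metric.closedBall (v i) δ) := by
  let u : ℕ → ℝ := fun k => 1 / ((k : ℝ) + 1)
  have hu0 : ∀ k, 0 < u k := fun k => by positivity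
  have hanti : Antitone u := fun i j hij => one_div_le_one_div_of_le (by positivity) (by
    have : (i : ℝ) ≤ j := Nat.cast_le.2 hij
    linarith)
  have hlim : Tendsto u atTop (𝓝 0) := tendsto_one_div_add_atTop_nhds_zero_nat
  let A : ℕ → Set (ℝ × ℝ) := fun k =>
    interior {z | ∀ w ∈ Metric.closedBall v (u k), z ∈ swept (extend w) n} \
      ⋃ i, Metric.closedBall (v i) (u k)
  have hAm : ∀ k, MeasurableSet (A k) := fun k => isOpen_interior.measurableSet.diff
    (MeasurableSet.iUnion fun i => Metric.isClosed_closedBall.measurableSet)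
  have hAmono : Monotone A := by
    intro i j hij
    refine Set.sdiff_subset_sdiff (interior_mono fun z hz w hw => hz w ?_)
      (Set.iUnion_mono fun i => Metric.closedBall_subset_closedBall (hanti hij))
    exact Metric.closedBall_subset_closedBall (hanti hij) hw
  have hAsub : ∀ k, ∀ w ∈ Metric.closedBall v (u k), A k ⊆ swept (extend w) n :=
    fun k w hw z hz => interior_subset hz.1 w hw
  have hsup : swept (extend v) n \ Set.range v ⊆ ⋃ k, A k := by
    rintro z ⟨hz, hzv⟩
    obtain ⟨δ, hδ, hball⟩ := Metric.eventually_nhds_iff_ball.1 (eventually_mem_swept h hz)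
    have e1 : ∀ᶠ k in atTop, u k < δ := (tendsto_order.1 hlim).2 _ hδ
    have e2 : ∀ᶠ k in atTop, ∀ i, u k < dist z (v i) := by
      rw [eventually_all]
      intro i
      exact (tendsto_order.1 hlim).2 _ (dist_pos.2 fun hh => hzv ⟨i, hh.symm⟩)
    obtain ⟨k, hk1, hk2⟩ := (e1.and e2).exists
    refine Set.mem_iUnion.2 ⟨k, ?_, ?_⟩
    · rw [mem_interior_iff_mem_nhds]
      filter_upwards [Metric.ball_mem_nhds z hδ] with z' hz' w hw
      refine hball (w, z') ?_
      rw [← ball_prod_same]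
      exact ⟨Metric.mem_ball.2 (hw.trans_lt hk1), hz'⟩
    · simp only [Set.mem_iUnion, Metric.mem_closedBall, not_exists, not_le]
      exact hk2
  have hfin : halfVolume (swept (extend v) n) ≠ ⊤ := by
    rw [halfVolume_swept h]; exact ENNReal.ofReal_ne_top
  have hAfin : ∀ k, halfVolume (A k) ≠ ⊤ := fun k =>
    ne_top_of_le_ne_top hfin (measure_mono (hAsub k v (Metric.mem_closedBall_self (hu0 k).le)))
  have hU : halfVolume (⋃ k, A k) = ENNReal.ofReal (totalRate (extend v) n) := by
    rw [← halfVolume_swept h]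
    refine le_antisymm (measure_mono (Set.iUnion_subset fun k =>
      hAsub k v (Metric.mem_closedBall_self (hu0 k).le))) ?_
    refine le_trans (le_of_eq ?_) (measure_mono hsup)
    rw [measure_sdiff_null]
    rw [halfVolume_apply, (Set.finite_range v).measure_zero, mul_zero]
  have hnn : 0 ≤ totalRate (extend v) n := Finset.sum_nonneg fun i hi =>
    h.rate_nonneg (by simpa [Nat.lt_succ_iff] using hi)
  have ht := tendsto_measure_iUnion_atTop (μ := halfVolume) hAmono
  rw [hU] at ht
  have ht' := (ENNReal.tendsto_toReal ENNReal.ofReal_ne_top).comp ht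
  rw [ENNReal.toReal_ofReal hnn] at ht'
  obtain ⟨k, hk⟩ := ((tendsto_order.1 ht').1 (totalRate (extend v) n - ε) (by linarith)).exists
  refine ⟨u k, hu0 k, A k, hAm k, hAfin k, hk.le, hAsub k, fun i => ?_⟩
  exact Set.disjoint_left.2 fun z hz hz' => hz.2 (Set.mem_iUnion.2 ⟨i, hz'⟩)

/-! ### Domination of the law of the vertices -/

theorem measurable_hitTime_extend {n : ℕ} (i : ℕ) :
    Measurable fun v : Fin (n + 1) → ℝ × ℝ => hitTime (extend v) i := by
  have h : ∀ j, Measurable fun v : Fin (n + 1) → ℝ × ℝ => extend v j :=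
    fun j => (continuous_extend j).measurable
  cases i with
  | zero => exact measurable_const
  | succ i =>
    have h1 := h i
    have h2 := h (i + 1)
    unfold hitTime
    fun_prop

theorem measurable_totalRate_extend {n : ℕ} (k : ℕ) :
    Measurable fun v : Fin (n + 1) → ℝ × ℝ => totalRate (extend v) k := by
  have h : ∀ j, Measurable fun v : Fin (n + 1) → ℝ × ℝ => extend v j :=
    fun j => (continuous_extend j).measurable
  refine Finset.measurable_fun_sum _ fun i _ => ?_
  cases i with
  | zero =>
    have h0 := h 0
    unfold rate
    fun_prop
  | succ i =>
    have h1 := h i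
    have h2 := measurable_hitTime_extend (n := n) i
    have h3 := measurable_hitTime_extend (n := n) (i + 1)
    unfold rate
    fun_prop

theorem measurableSet_admissible (n : ℕ) :
    MeasurableSet {v : Fin (n + 1) → ℝ × ℝ | Admissible (extend v) n} := by
  refine IsOpen.measurableSet ?_
  rw [isOpen_iff_mem_nhds]
  exact fun v hv => eventually_admissible hv

/-- The joint density of the first `n + 1` vertices: each contributes the intensity `1 / 2`, and the
swept region has to be void. -/
def pathDensity (n : ℕ) : (Fin (n + 1) → ℝ × ℝ) → ℝ≥0∞ :=
  Set.indicator {v | Admissible (extend v) n}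
    fun v => ENNReal.ofReal ((1 / 2) ^ (n + 1) * Real.exp (-totalRate (extend v) n))

theorem pathDensity_of_admissible {n : ℕ} {v : Fin (n + 1) → ℝ × ℝ}
    (h : Admissible (extend v) n) : pathDensity n v =
      ENNReal.ofReal ((1 / 2) ^ (n + 1) * Real.exp (-totalRate (extend v) n)) :=
  Set.indicator_of_mem (s := {v : Fin (n + 1) → ℝ × ℝ | Admissible (extend v) n}) h _

theorem pathDensity_of_not_admissible {n : ℕ} {v : Fin (n + 1) → ℝ × ℝ}
    (h : ¬ Admissible (extend v) n) : pathDensity n v = 0 :=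
  Set.indicator_of_notMem (s := {v : Fin (n + 1) → ℝ × ℝ | Admissible (extend v) n}) h _

/-- The measure with density `pathDensity n`, which is the joint law of the first `n + 1` vertices
by `measure_path_le` and equality of the total masses. -/
def pathMeasure (n : ℕ) : Measure (Fin (n + 1) → ℝ × ℝ) := volume.withDensity (pathDensity n)

theorem measurable_pathDensity (n : ℕ) : Measurable (pathDensity n) := by
  refine Measurable.indicator ?_ (measurableSet_admissible n)
  have := measurable_totalRate_extend (n := n) n
  fun_prop

theorem prod_halfVolume_closedBall {n : ℕ} (v : Fin (n + 1) → ℝ × ℝ) {r : ℝ} (hr : 0 ≤ r) :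
    ∏ i, halfVolume (Metric.closedBall (v i) r) =
      ENNReal.ofReal ((1 / 2) ^ (n + 1)) * volume (Metric.closedBall v r) := by
  simp only [halfVolume_apply, Finset.prod_mul_distrib, Finset.prod_const, Finset.card_univ,
    Fintype.card_fin]
  rw [closedBall_pi _ hr, volume_pi_pi, inv_two_eq_ofReal, ENNReal.ofReal_pow (by norm_num)]

theorem halfVolume_closedBall_ne_top (z : ℝ × ℝ) (r : ℝ) :
    halfVolume (Metric.closedBall z r) ≠ ⊤ := by
  rw [halfVolume_apply]
  exact ENNReal.mul_ne_top (by simp) (isCompact_closedBall z r).measure_lt_top.ne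

section Local

variable {Ω : Type*} [MeasurableSpace Ω] {μ : Measure Ω} [IsProbabilityMeasure μ]
  {P : Ω → Set (ℝ × ℝ)} {X : Ω → ℕ → ℝ × ℝ}

/-- The probability that a region is void while finitely many other regions are occupied, all being
disjoint. -/
theorem IsPoissonProcess.measure_void_occupied_le (hP : IsPoissonProcess P halfVolume μ) {n : ℕ}
    {K : Set (ℝ × ℝ)} {Q : Fin n → Set (ℝ × ℝ)} (hK : MeasurableSet K)
    (hQ : ∀ i, MeasurableSet (Q i)) (hKfin : halfVolume K ≠ ⊤) (hQfin : ∀ i, halfVolume (Q i) ≠ ⊤)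
    (hKQ : ∀ i, Disjoint K (Q i)) (hQQ : ∀ i j, i ≠ j → Disjoint (Q i) (Q j)) :
    μ {ω | P ω ∩ K = ∅ ∧ ∀ i, (P ω ∩ Q i).Nonempty} ≤
      ENNReal.ofReal (Real.exp (-(halfVolume K).toReal)) * ∏ i, halfVolume (Q i) := by
  let A : Fin (n + 1) → Set (ℝ × ℝ) := Fin.cons K Q
  have hA : ∀ i, MeasurableSet (A i) := fun i => by
    refine Fin.cases ?_ (fun i => ?_) i
    · simpa [A] using hK
    · simpa [A] using hQ i
  have hdisj : ∀ i j, i ≠ j → Disjoint (A i) (A j) := by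
    intro i j
    refine Fin.cases ?_ (fun i => ?_) i <;> refine Fin.cases ?_ (fun j => ?_) j
    · intro h; exact absurd rfl h
    · intro _; simpa [A] using hKQ j
    · intro _; simpa [A] using (hKQ i).symm
    · intro h; simpa [A] using hQQ i j (fun hh => h (congrArg Fin.succ hh))
  let C : Fin (n + 1) → Set ℕ∞ := Fin.cons {0} fun _ => {0}ᶜ
  have hC : ∀ i, MeasurableSet (C i) := fun i => by
    refine Fin.cases ?_ (fun i => ?_) i
    · simp [C]
    · simp [C]
  have h := (hP.indep_counts (n + 1) A hA hdisj).measure_inter_preimage_eq_mul Finset.univ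
    (sets := C) (fun i _ => hC i)
  have e : {ω | P ω ∩ K = ∅ ∧ ∀ i, (P ω ∩ Q i).Nonempty} =
      ⋂ i ∈ Finset.univ, (fun ω => (P ω ∩ A i).encard) ⁻¹' C i := by
    ext ω
    simp [Fin.forall_fin_succ, A, C, Set.nonempty_iff_ne_empty]
  rw [e, h, Fin.prod_univ_succ]
  refine mul_le_mul' (le_of_eq ?_) (Finset.prod_le_prod' fun i _ => ?_)
  · rw [← hP.measure_inter_eq_empty hK hKfin]
    congr 1
    ext ω
    simp [A, C]
  · refine le_trans (le_of_eq ?_) (hP.measure_inter_nonempty_le (hQ i) (hQfin i))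
    congr 1
    ext ω
    simp [A, C, Set.nonempty_iff_ne_empty]

/-- The law of the first vertices is dominated by `pathMeasure` on small cubes, up to a factor close
to one. Balls of the product are cubes for the supremum norm. -/
theorem IsPoissonProcess.eventually_measure_closedBall_le (hP : IsPoissonProcess P halfVolume μ)
    (hX : ∀ᵐ ω ∂μ, IsHullChain (P ω) (X ω)) {n : ℕ} {v : Fin (n + 1) → ℝ × ℝ}
    (hv : Admissible (extend v) n) {ε : ℝ} (hε : 0 < ε) :
    ∀ᶠ r in 𝓝[>] (0 : ℝ), μ {ω | (fun i : Fin (n + 1) => X ω i) ∈ Metric.closedBall v r} ≤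
      ENNReal.ofReal (Real.exp ε) * pathMeasure n (Metric.closedBall v r) := by
  obtain ⟨δ, hδ, K, hK, hKfin, hKrate, hKsub, hKdisj⟩ :=
    exists_inner_region hv (half_pos hε)
  have h1 : ∀ᶠ w in 𝓝 v, Admissible (extend w) n ∧
      totalRate (extend w) n < totalRate (extend v) n + ε / 2 :=
    (eventually_admissible hv).and
      ((tendsto_order.1 (continuousAt_totalRate hv)).2 _ (by linarith))
  obtain ⟨δ', hδ', hball⟩ := Metric.eventually_nhds_iff_ball.1 h1
  have hlt : ∀ i j : ℕ, i < j → j ≤ n → (extend v j).1 < (extend v i).1 := by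
    intro i j hij hj
    induction j, hij using Nat.le_induction with
    | base => exact (hv.2.2 i hj).2.1
    | succ j hij ih => exact (hv.2.2 j hj).2.1.trans (ih (by omega))
  have hinj : ∀ i j : Fin (n + 1), i ≠ j → v i ≠ v j := by
    intro i j hij h
    have hext : ∀ k : Fin (n + 1), extend v k = v k := fun k => dif_pos k.2
    rcases lt_or_gt_of_ne hij with h' | h'
    · have := hlt i j h' (by omega)
      rw [hext, hext, h] at this
      exact this.false
    · have := hlt j i h' (by omega)
      rw [hext, hext, h] at this
      exact this.false
  have h3 : ∀ᶠ r in 𝓝[>] (0 : ℝ), ∀ i j : Fin (n + 1), i ≠ j → r < dist (v i) (v j) / 2 := by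
    simp only [eventually_all]
    intro i j hij
    exact (eventually_lt_nhds (half_pos (dist_pos.2 (hinj i j hij)))).filter_mono
      nhdsWithin_le_nhds
  filter_upwards [h3, Ioo_mem_nhdsGT hδ, Ioo_mem_nhdsGT hδ'] with r hr3 hr1 hr2
  have hr0 : 0 ≤ r := hr1.1.le
  have hA : μ {ω | (fun i : Fin (n + 1) => X ω i) ∈ Metric.closedBall v r} ≤
      μ {ω | P ω ∩ K = ∅ ∧ ∀ i, (P ω ∩ Metric.closedBall (v i) r).Nonempty} := by
    refine measure_mono_ae ?_
    filter_upwards [hX] with ω hω hmem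
    have hmem : (fun i : Fin (n + 1) => X ω i) ∈ Metric.closedBall v r := hmem
    refine ⟨?_, fun i => ⟨X ω i, hω.mem i, ?_⟩⟩
    · have hsub := hKsub _ (Metric.closedBall_subset_closedBall hr1.2.le hmem)
      rw [swept_congr fun i hi => extend_restrict (X ω) hi] at hsub
      rw [← Set.disjoint_iff_inter_eq_empty]
      refine Set.disjoint_of_subset_right hsub ?_
      simp only [swept, Set.disjoint_iUnion_right]
      exact fun i _ => hω.disjoint i
    · rw [closedBall_pi _ hr0] at hmem
      exact hmem i (Set.mem_univ i)
  have hB := hP.measure_void_occupied_le hK (Q := fun i => Metric.closedBall (v i) r)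
    (fun i => Metric.isClosed_closedBall.measurableSet) hKfin
    (fun i => halfVolume_closedBall_ne_top _ _)
    (fun i => (hKdisj i).mono_right (Metric.closedBall_subset_closedBall hr1.2.le))
    (fun i j hij => Metric.closedBall_disjoint_closedBall (by linarith [hr3 i j hij]))
  rw [prod_halfVolume_closedBall v hr0] at hB
  have hC : ENNReal.ofReal ((1 / 2) ^ (n + 1) * Real.exp (-(totalRate (extend v) n + ε / 2))) *
      volume (Metric.closedBall v r) ≤ pathMeasure n (Metric.closedBall v r) := by
    rw [pathMeasure, withDensity_apply _ Metric.isClosed_closedBall.measurableSet,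
      ← setLIntegral_const]
    refine setLIntegral_mono' Metric.isClosed_closedBall.measurableSet fun w hw => ?_
    obtain ⟨hw1, hw2⟩ := hball w (Metric.mem_ball.2 (lt_of_le_of_lt hw hr2.2))
    rw [pathDensity_of_admissible hw1]
    gcongr
  refine hA.trans (hB.trans ?_)
  refine le_trans ?_ (mul_le_mul_right hC _)
  rw [← mul_assoc, ← mul_assoc, ← ENNReal.ofReal_mul (Real.exp_pos _).le,
    ← ENNReal.ofReal_mul (Real.exp_pos _).le]
  refine mul_le_mul_left (ENNReal.ofReal_le_ofReal ?_) _
  have : Real.exp (-(halfVolume K).toReal) ≤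
      Real.exp ε * Real.exp (-(totalRate (extend v) n + ε / 2)) := by
    rw [← Real.exp_add]
    exact Real.exp_le_exp.2 (by linarith)
  calc Real.exp (-(halfVolume K).toReal) * (1 / 2) ^ (n + 1)
      ≤ (Real.exp ε * Real.exp (-(totalRate (extend v) n + ε / 2))) * (1 / 2) ^ (n + 1) := by gcongr
    _ = _ := by ring

/-- Domination on small cubes extends to all sets, measurable or not: by the Besicovitch theorem a
set is covered by small cubes whose masses add up to little more than its own. -/
theorem IsPoissonProcess.measure_path_le (hP : IsPoissonProcess P halfVolume μ)
    (hX : ∀ᵐ ω ∂μ, IsHullChain (P ω) (X ω)) (n : ℕ) [IsFiniteMeasure (pathMeasure n)]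
    (s : Set (Fin (n + 1) → ℝ × ℝ)) :
    μ {ω | (fun i : Fin (n + 1) => X ω i) ∈ s} ≤ pathMeasure n s := by
  have key : ∀ ε : ℝ, 0 < ε → μ {ω | (fun i : Fin (n + 1) => X ω i) ∈ s} ≤
      ENNReal.ofReal (Real.exp ε) * (pathMeasure n s + ENNReal.ofReal ε) := by
    intro ε hε
    let G : Set (Fin (n + 1) → ℝ × ℝ) := s ∩ {v | Admissible (extend v) n}
    let f : (Fin (n + 1) → ℝ × ℝ) → Set ℝ := fun v =>
      {r | μ {ω | (fun i : Fin (n + 1) => X ω i) ∈ Metric.closedBall v r} ≤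
        ENNReal.ofReal (Real.exp ε) * pathMeasure n (Metric.closedBall v r)}
    obtain ⟨t, r, htc, -, htr, hcov, hsum⟩ :=
      Besicovitch.exists_closedBall_covering_tsum_measure_le (pathMeasure n)
        (ε := ENNReal.ofReal ε) (by simpa using hε) f G (fun v hv δ hδ =>
          ((hP.eventually_measure_closedBall_le hX hv.2 hε).and (Ioo_mem_nhdsGT hδ)).exists)
    have : Countable t := htc.to_subtype
    calc μ {ω | (fun i : Fin (n + 1) => X ω i) ∈ s}
        ≤ μ (⋃ v : t, {ω | (fun i : Fin (n + 1) => X ω i) ∈ Metric.closedBall v.1 (r v)}) := by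
          refine measure_mono_ae ?_
          filter_upwards [hX] with ω hω hs
          have hG : (fun i : Fin (n + 1) => X ω i) ∈ G :=
            ⟨hs, (hω.admissible n).congr fun i hi => (extend_restrict (X ω) hi).symm⟩
          obtain ⟨v, hv, hmem⟩ := Set.mem_iUnion₂.1 (hcov hG)
          exact Set.mem_iUnion.2 ⟨⟨v, hv⟩, hmem⟩
      _ ≤ ∑' v : t, μ {ω | (fun i : Fin (n + 1) => X ω i) ∈ Metric.closedBall v.1 (r v)} :=
          measure_iUnion_le _
      _ ≤ ∑' v : t, ENNReal.ofReal (Real.exp ε) * pathMeasure n (Metric.closedBall v.1 (r v)) :=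
          ENNReal.tsum_le_tsum fun v => htr v v.2
      _ = ENNReal.ofReal (Real.exp ε) * ∑' v : t, pathMeasure n (Metric.closedBall v.1 (r v)) :=
          ENNReal.tsum_mul_left
      _ ≤ ENNReal.ofReal (Real.exp ε) * (pathMeasure n G + ENNReal.ofReal ε) := by gcongr
      _ ≤ _ := by
          gcongr
          exact Set.inter_subset_left
  have hlim : Tendsto (fun ε : ℝ => ENNReal.ofReal (Real.exp ε) *
      (pathMeasure n s + ENNReal.ofReal ε)) (𝓝[>] 0) (𝓝 (1 * (pathMeasure n s + 0))) := by
    refine ENNReal.Tendsto.mul ?_ (Or.inl one_ne_zero) ?_ (Or.inr ENNReal.one_ne_top)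
    · have : Continuous fun ε : ℝ => ENNReal.ofReal (Real.exp ε) :=
        ENNReal.continuous_ofReal.comp Real.continuous_exp
      simpa using (this.tendsto 0).mono_left nhdsWithin_le_nhds
    · have : Continuous fun ε : ℝ => ENNReal.ofReal ε := ENNReal.continuous_ofReal
      refine tendsto_const_nhds.add ?_
      simpa using (this.tendsto 0).mono_left (nhdsWithin_le_nhds (s := Set.Ioi 0))
  rw [one_mul, add_zero] at hlim
  refine ge_of_tendsto hlim ?_
  filter_upwards [self_mem_nhdsWithin] with ε hε using key ε hε

end Local

/-- A map whose law, as an outer measure, is dominated by a probability measure is null-measurable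
with that law: the outer measures of the preimages of a set and of its complement add up to one. -/
theorem nullMeasurable_of_measure_preimage_le {Ω E : Type*} [MeasurableSpace Ω]
    [MeasurableSpace E] {μ : Measure Ω} [IsProbabilityMeasure μ] {m : Measure E}
    [IsProbabilityMeasure m] {f : Ω → E} (h : ∀ s, MeasurableSet s → μ (f ⁻¹' s) ≤ m s) :
    NullMeasurable f μ ∧ ∀ s, MeasurableSet s → μ (f ⁻¹' s) = m s := by
  have key : ∀ s, MeasurableSet s → μ (f ⁻¹' s) + μ (f ⁻¹' sᶜ) = 1 := by
    intro s hs
    refine le_antisymm ?_ ?_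
    · rw [← prob_add_prob_compl (μ := m) hs]
      exact add_le_add (h s hs) (h _ hs.compl)
    · rw [← measure_univ (μ := μ), ← Set.union_compl_self (f ⁻¹' s)]
      exact measure_union_le _ _
  refine ⟨fun s hs => ?_, fun s hs => ?_⟩
  · set T := toMeasurable μ (f ⁻¹' s)
    set T' := toMeasurable μ (f ⁻¹' sᶜ)
    have hT : MeasurableSet T := measurableSet_toMeasurable _ _
    have hT' : MeasurableSet T' := measurableSet_toMeasurable _ _
    have hsT : f ⁻¹' s ⊆ T := subset_toMeasurable _ _
    have hsT' : (f ⁻¹' s)ᶜ ⊆ T' := subset_toMeasurable μ (f ⁻¹' sᶜ)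
    have hsum : μ T + μ T' = 1 := by
      rw [measure_toMeasurable, measure_toMeasurable]; exact key s hs
    have hun : T ∪ T' = Set.univ := by
      refine Set.eq_univ_of_forall fun ω => ?_
      by_cases hω : ω ∈ f ⁻¹' s
      · exact Or.inl (hsT hω)
      · exact Or.inr (hsT' hω)
    have hint : μ (T ∩ T') = 0 := by
      have := measure_union_add_inter (μ := μ) T hT'
      rw [hun, measure_univ, hsum] at this
      exact (ENNReal.add_right_inj ENNReal.one_ne_top).1 (this.trans (add_zero 1).symm)
    refine NullMeasurableSet.congr hT.nullMeasurableSet ?_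
    refine (ae_eq_set.2 ⟨measure_mono_null ?_ hint, ?_⟩)
    · rintro ω ⟨h1, h2⟩
      exact ⟨h1, hsT' h2⟩
    · rw [Set.sdiff_eq_empty.2 hsT, measure_empty]
  · refine le_antisymm (h s hs) ?_
    have h1 := key s hs
    have h2 : m sᶜ ≠ ⊤ := measure_ne_top m _
    refine (ENNReal.add_le_add_iff_right h2).1 ?_
    rw [prob_add_prob_compl hs, ← h1]
    gcongr
    exact h _ hs.compl

/-! ### Integration of one step -/

theorem lintegral_exp_shift {κ : ℝ} (hκ : 0 < κ) (m : ℝ) :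
    ∫⁻ a in Set.Ioi m, ENNReal.ofReal (1 / 2 * Real.exp (-(κ * (a - m)))) =
      ENNReal.ofReal (1 / (2 * κ)) := by
  have e : ∀ a, 1 / 2 * Real.exp (-(κ * (a - m))) =
      1 / 2 * Real.exp (κ * m) * Real.exp (-κ * a) := fun a => by
    rw [mul_assoc, ← Real.exp_add]
    congr 2
    ring
  simp only [e]
  rw [← ofReal_integral_eq_lintegral_ofReal, integral_const_mul,
    integral_exp_mul_Ioi (neg_lt_zero.2 hκ)]
  · congr 1
    rw [neg_div_neg_eq, mul_div_assoc', mul_assoc, ← Real.exp_add]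
    simp
    ring
  · exact (integrableOn_exp_mul_Ioi (neg_lt_zero.2 hκ) m).const_mul _
  · exact Eventually.of_forall fun a => by positivity

/-- The conditional density of the next vertex `z` when the current vertex is `p`, reached at
inverse abscissa `t`. -/
def stepDensity (t : ℝ) (p z : ℝ × ℝ) : ℝ≥0∞ :=
  if 0 < z.1 ∧ z.1 < p.1 ∧ t < (z.2 - p.2) / (p.1 - z.1) then
    ENNReal.ofReal (1 / 2 * Real.exp (-(p.1 ^ 2 / 4 * ((z.2 - p.2) / (p.1 - z.1) - t))))
  else 0

@[fun_prop]
theorem measurable_stepDensity {α : Type*} [MeasurableSpace α] {t : α → ℝ} {p z : α → ℝ × ℝ}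
    (ht : Measurable t) (hp : Measurable p) (hz : Measurable z) :
    Measurable fun x => stepDensity (t x) (p x) (z x) := by
  unfold stepDensity
  refine Measurable.ite ?_ (by fun_prop) measurable_const
  exact (measurableSet_lt (by fun_prop) (by fun_prop) : MeasurableSet {x | 0 < (z x).1}).inter
    ((measurableSet_lt (by fun_prop) (by fun_prop) : MeasurableSet {x | (z x).1 < (p x).1}).inter
      (measurableSet_lt ht (by fun_prop)))

theorem lintegral_stepDensity_fiber {p : ℝ × ℝ} (hp : 0 < p.1) (t b : ℝ) :
    ∫⁻ a, stepDensity t p (b, a) =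
      (Set.Ioo 0 p.1).indicator (fun b => ENNReal.ofReal (2 * (p.1 - b) / p.1 ^ 2)) b := by
  by_cases hb : b ∈ Set.Ioo 0 p.1
  · have hc : 0 < p.1 - b := sub_pos.2 hb.2
    rw [Set.indicator_of_mem hb]
    have e : ∀ a, stepDensity t p (b, a) = (Set.Ioi (p.2 + t * (p.1 - b))).indicator (fun a =>
        ENNReal.ofReal (1 / 2 * Real.exp (-(p.1 ^ 2 / 4 / (p.1 - b) *
          (a - (p.2 + t * (p.1 - b))))))) a := by
      intro a
      have hiff : t < (a - p.2) / (p.1 - b) ↔ p.2 + t * (p.1 - b) < a := by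
        rw [lt_div_iff₀ hc]
        constructor <;> intro h <;> linarith
      simp only [stepDensity, hb.1, hb.2, true_and, hiff, Set.indicator, Set.mem_Ioi]
      split_ifs
      · congr 4
        field_simp
        ring
      · rfl
    simp only [e]
    rw [lintegral_indicator measurableSet_Ioi, lintegral_exp_shift (by positivity)]
    congr 1
    field_simp
    norm_num
  · rw [Set.indicator_of_notMem hb]
    have e : ∀ a, stepDensity t p (b, a) = 0 := fun a =>
      if_neg fun h => hb ⟨h.1, h.2.1⟩
    simp [e]

/-- Under the step density, the squared relative drop of the intercept is uniform on `[0, 1]`,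
whatever the current state. -/
theorem lintegral_stepDensity {p : ℝ × ℝ} (hp : 0 < p.1) (t : ℝ) {g : ℝ → ℝ≥0∞}
    (hg : Measurable g) :
    ∫⁻ z, stepDensity t p z * g (((p.1 - z.1) / p.1) ^ 2) = ∫⁻ w in Set.Icc 0 1, g w := by
  rw [Measure.volume_eq_prod, lintegral_prod _ (by fun_prop)]
  have inner : ∀ b, ∫⁻ a, stepDensity t p (b, a) * g (((p.1 - b) / p.1) ^ 2) =
      (Set.Ioo 0 p.1).indicator (fun b => ENNReal.ofReal (2 * (p.1 - b) / p.1 ^ 2) *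
        g (((p.1 - b) / p.1) ^ 2)) b := by
    intro b
    rw [lintegral_mul_const _ (by fun_prop), lintegral_stepDensity_fiber hp,
      Set.indicator_mul_left]
  simp only [inner]
  rw [lintegral_indicator measurableSet_Ioo]
  have himg : (fun b => ((p.1 - b) / p.1) ^ 2) '' Set.Ioo 0 p.1 = Set.Ioo 0 1 := by
    ext w
    constructor
    · rintro ⟨b, ⟨h1, h2⟩, rfl⟩
      have h3 : 0 < (p.1 - b) / p.1 := div_pos (sub_pos.2 h2) hp
      have h4 : (p.1 - b) / p.1 < 1 := by rw [div_lt_one hp]; linarith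
      exact ⟨by positivity, by simp only; nlinarith⟩
    · rintro ⟨h1, h2⟩
      have h3 : 0 < √w := Real.sqrt_pos.2 h1
      have h4 : √w < 1 := by
        rw [Real.sqrt_lt' one_pos]; simpa using h2
      refine ⟨p.1 * (1 - √w), ⟨by nlinarith, by nlinarith⟩, ?_⟩
      have : (p.1 - p.1 * (1 - √w)) / p.1 = √w := by
        field_simp
        ring
      simp only [this, Real.sq_sqrt h1.le]
  have hinj : Set.InjOn (fun b => ((p.1 - b) / p.1) ^ 2) (Set.Ioo 0 p.1) := by
    intro b hb b' hb' h
    have h1 : 0 ≤ (p.1 - b) / p.1 := (div_pos (sub_pos.2 hb.2) hp).le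
    have h2 : 0 ≤ (p.1 - b') / p.1 := (div_pos (sub_pos.2 hb'.2) hp).le
    have h3 := (pow_left_inj₀ h1 h2 two_ne_zero).1 h
    rw [div_left_inj' hp.ne'] at h3
    linarith
  have hderiv : ∀ b ∈ Set.Ioo 0 p.1, HasDerivWithinAt (fun b => ((p.1 - b) / p.1) ^ 2)
      (-(2 * (p.1 - b) / p.1 ^ 2)) (Set.Ioo 0 p.1) b := by
    intro b _
    refine HasDerivAt.hasDerivWithinAt ?_
    have h := ((((hasDerivAt_id b).const_sub p.1).div_const p.1).pow 2)
    convert! h using 1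
    simp
    field_simp
  have h := lintegral_image_eq_lintegral_abs_deriv_mul measurableSet_Ioo hderiv hinj g
  rw [himg] at h
  rw [← restrict_Ioo_eq_restrict_Icc, h]
  refine setLIntegral_congr_fun measurableSet_Ioo fun b hb => ?_
  rw [abs_neg, abs_of_nonneg]
  exact div_nonneg (by linarith [hb.2]) (sq_nonneg _)

theorem extend_init {n : ℕ} (v : Fin (n + 2) → ℝ × ℝ) {i : ℕ} (hi : i ≤ n) :
    extend v i = extend (Fin.init v) i := by
  have h1 : i < n + 1 := by omega
  have h2 : i < n + 1 + 1 := by omega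
  simp only [extend, h1, h2, dif_pos, Fin.init]
  rfl

theorem extend_self {n : ℕ} (v : Fin (n + 1) → ℝ × ℝ) : extend v n = v (Fin.last n) := by
  simp [extend, Fin.last]

theorem pathDensity_succ {n : ℕ} (v : Fin (n + 2) → ℝ × ℝ) :
    pathDensity (n + 1) v = pathDensity n (Fin.init v) *
      stepDensity (hitTime (extend (Fin.init v)) n) (Fin.init v (Fin.last n))
        (v (Fin.last (n + 1))) := by
  have e : ∀ i ≤ n, extend v i = extend (Fin.init v) i := fun i hi => extend_init v hi
  have e1 : (extend v n) = Fin.init v (Fin.last n) := by rw [e n le_rfl, extend_self]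
  have e2 : extend v (n + 1) = v (Fin.last (n + 1)) := extend_self v
  have ht : hitTime (extend v) n = hitTime (extend (Fin.init v)) n := hitTime_congr e
  have ht' : hitTime (extend v) (n + 1) = ((v (Fin.last (n + 1))).2 -
      (Fin.init v (Fin.last n)).2) / ((Fin.init v (Fin.last n)).1 - (v (Fin.last (n + 1))).1) := by
    rw [hitTime, e1, e2]
  have hadm : Admissible (extend v) (n + 1) ↔ Admissible (extend (Fin.init v)) n ∧
      0 < (v (Fin.last (n + 1))).1 ∧ (v (Fin.last (n + 1))).1 < (Fin.init v (Fin.last n)).1 ∧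
      hitTime (extend (Fin.init v)) n < ((v (Fin.last (n + 1))).2 -
      (Fin.init v (Fin.last n)).2) / ((Fin.init v (Fin.last n)).1 - (v (Fin.last (n + 1))).1) := by
    rw [← admissible_congr e, ← ht', ← ht, ← e1, ← e2]
    constructor
    · rintro ⟨h1, h2, h3⟩
      exact ⟨⟨h1, h2, fun i hi => h3 i (by omega)⟩, h3 n (by omega)⟩
    · rintro ⟨⟨h1, h2, h3⟩, h4⟩
      refine ⟨h1, h2, fun i hi => ?_⟩
      rcases Nat.lt_succ_iff_lt_or_eq.1 hi with hi | rfl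
      · exact h3 i hi
      · exact h4
  have hrate : totalRate (extend v) (n + 1) = totalRate (extend (Fin.init v)) n +
      (Fin.init v (Fin.last n)).1 ^ 2 / 4 * (((v (Fin.last (n + 1))).2 -
      (Fin.init v (Fin.last n)).2) / ((Fin.init v (Fin.last n)).1 - (v (Fin.last (n + 1))).1) -
        hitTime (extend (Fin.init v)) n) := by
    rw [totalRate, Finset.sum_range_succ, ← totalRate, totalRate_congr e, rate, ht', ht, e1]
  by_cases h1 : Admissible (extend (Fin.init v)) n
  · by_cases h2 : 0 < (v (Fin.last (n + 1))).1 ∧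
      (v (Fin.last (n + 1))).1 < (Fin.init v (Fin.last n)).1 ∧
      hitTime (extend (Fin.init v)) n < ((v (Fin.last (n + 1))).2 -
      (Fin.init v (Fin.last n)).2) / ((Fin.init v (Fin.last n)).1 - (v (Fin.last (n + 1))).1)
    · rw [pathDensity_of_admissible (hadm.2 ⟨h1, h2⟩), pathDensity_of_admissible h1,
        stepDensity, if_pos h2, ← ENNReal.ofReal_mul (by positivity),
        hrate, neg_add, Real.exp_add]
      congr 1
      ring
    · rw [pathDensity_of_not_admissible fun h => h2 (hadm.1 h).2, stepDensity, if_neg h2,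
        mul_zero]
  · rw [pathDensity_of_not_admissible fun h => h1 (hadm.1 h).1,
      pathDensity_of_not_admissible h1, zero_mul]

/-- The squared relative drop of the intercept from `p` to `z`: the fraction of the area of a
triangle with apex `p` and base on the axis of zero intercept that is taken up by the points of
intercept larger than that of `z`. -/
def areaFraction (p z : ℝ × ℝ) : ℝ := ((p.1 - z.1) / p.1) ^ 2

/-- One step of the chain: the next area fraction is uniform and independent of the past. -/
theorem pathMeasure_succ (n : ℕ) {B : Set (Fin (n + 1) → ℝ × ℝ)} (hB : MeasurableSet B)
    {A : Set ℝ} (hA : MeasurableSet A) :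
    pathMeasure (n + 1) {v | Fin.init v ∈ B ∧
      areaFraction (Fin.init v (Fin.last n)) (v (Fin.last (n + 1))) ∈ A} =
      pathMeasure n B * volume (A ∩ Set.Icc 0 1) := by
  let F : (ℝ × ℝ) × (Fin (n + 1) → ℝ × ℝ) → ℝ≥0∞ := fun q =>
    B.indicator (pathDensity n) q.2 * (stepDensity (hitTime (extend q.2) n)
      (q.2 (Fin.last n)) q.1 * A.indicator 1 ((((q.2 (Fin.last n)).1 - q.1.1) /
        (q.2 (Fin.last n)).1) ^ 2))
  have hind : Measurable (A.indicator (1 : ℝ → ℝ≥0∞)) := measurable_one.indicator hA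
  have hF : Measurable F := by
    have h1 : Measurable (B.indicator (pathDensity n)) := (measurable_pathDensity n).indicator hB
    have h2 := measurable_hitTime_extend (n := n) n
    have h3 : Measurable fun q : (ℝ × ℝ) × (Fin (n + 1) → ℝ × ℝ) => q.2 (Fin.last n) :=
      (measurable_pi_apply _).comp measurable_snd
    have h4 : Measurable fun q : (ℝ × ℝ) × (Fin (n + 1) → ℝ × ℝ) => hitTime (extend q.2) n :=
      h2.comp measurable_snd
    exact (h1.comp measurable_snd).mul ((measurable_stepDensity h4 h3 measurable_fst).mul
      (hind.comp (by fun_prop)))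
  have hS : MeasurableSet {v : Fin (n + 2) → ℝ × ℝ | Fin.init v ∈ B ∧
      areaFraction (Fin.init v (Fin.last n)) (v (Fin.last (n + 1))) ∈ A} := by
    have h1 : Measurable fun v : Fin (n + 2) → ℝ × ℝ => (Fin.init v : Fin (n + 1) → ℝ × ℝ) :=
      measurable_pi_lambda _ fun i => measurable_pi_apply _
    have h2 : Measurable fun v : Fin (n + 2) → ℝ × ℝ =>
        areaFraction (Fin.init v (Fin.last n)) (v (Fin.last (n + 1))) := by
      unfold areaFraction Fin.init
      fun_prop
    exact (h1 hB).inter (h2 hA)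
  have he := volume_preserving_piFinSuccAbove (fun _ : Fin (n + 2) => ℝ × ℝ) (Fin.last (n + 1))
  rw [pathMeasure, withDensity_apply _ hS, ← lintegral_indicator hS]
  have e1 : ∀ v, Set.indicator {v : Fin (n + 2) → ℝ × ℝ | Fin.init v ∈ B ∧
      areaFraction (Fin.init v (Fin.last n)) (v (Fin.last (n + 1))) ∈ A} (pathDensity (n + 1)) v =
      F (MeasurableEquiv.piFinSuccAbove (fun _ : Fin (n + 2) => ℝ × ℝ) (Fin.last (n + 1)) v) := by
    intro v
    have e2 : MeasurableEquiv.piFinSuccAbove (fun _ : Fin (n + 2) => ℝ × ℝ) (Fin.last (n + 1)) v =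
        (v (Fin.last (n + 1)), Fin.init v) := by
      ext i
      · rfl
      · rfl
      · simp [MeasurableEquiv.piFinSuccAbove, Fin.init]
      · simp [MeasurableEquiv.piFinSuccAbove, Fin.init]
    rw [e2]
    simp only [F, Set.indicator, Set.mem_ofPred_eq, areaFraction, pathDensity_succ]
    by_cases h1 : Fin.init v ∈ B
    · by_cases h2 : ((((Fin.init v (Fin.last n)).1 - (v (Fin.last (n + 1))).1) /
        (Fin.init v (Fin.last n)).1) ^ 2) ∈ A
      · simp [h1, h2]
      · simp [h1, h2]
    · simp [h1]
  simp only [e1]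
  rw [he.lintegral_comp hF, Measure.volume_eq_prod, lintegral_prod_symm _ hF.aemeasurable]
  have e3 : ∀ w : Fin (n + 1) → ℝ × ℝ, ∫⁻ z, F (z, w) =
      B.indicator (pathDensity n) w * volume (A ∩ Set.Icc 0 1) := by
    intro w
    by_cases hw : Admissible (extend w) n
    · have hpos : 0 < (w (Fin.last n)).1 := by
        rw [← extend_self w]; exact hw.fst_pos le_rfl
      simp only [F]
      rw [lintegral_const_mul _ (by fun_prop), lintegral_stepDensity hpos _ hind,
        lintegral_indicator hA]
      simp [Measure.restrict_restrict hA]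
    · have : B.indicator (pathDensity n) w = 0 := by
        simp [Set.indicator, pathDensity, hw]
      simp [F, this]
  simp only [e3]
  rw [lintegral_mul_const _ ((measurable_pathDensity n).indicator hB), lintegral_indicator hB,
    pathMeasure, withDensity_apply _ hB]

/-! ### Almost sure existence of the chain -/

section Chain

variable {Ω : Type*} [MeasurableSpace Ω] {μ : Measure Ω} {P : Ω → Set (ℝ × ℝ)}

theorem IsPoissonProcess.ae_finite_triangle (hP : IsPoissonProcess P halfVolume μ) :
    ∀ᵐ ω ∂μ, ∀ c : ℝ, {z | z ∈ P ω ∧ 0 < z.1 ∧ 0 < z.2 ∧ z.1 + z.2 ≤ c}.Finite := by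
  have h : ∀ᵐ ω ∂μ, ∀ k : ℕ, (P ω ∩ Metric.closedBall 0 k).Finite :=
    ae_all_iff.2 fun k => hP.ae_finite Metric.isClosed_closedBall.measurableSet
      (halfVolume_closedBall_ne_top _ _)
  filter_upwards [h] with ω hω c
  obtain ⟨k, hk⟩ := exists_nat_ge c
  refine (hω k).subset fun z hz => ⟨hz.1, ?_⟩
  obtain ⟨-, h1, h2, h3⟩ := hz
  rw [mem_closedBall_zero_iff, Prod.norm_def, Real.norm_of_nonneg h1.le,
    Real.norm_of_nonneg h2.le]
  exact max_le (by linarith) (by linarith)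

theorem IsPoissonProcess.ae_exists_fst_lt (hP : IsPoissonProcess P halfVolume μ) :
    ∀ᵐ ω ∂μ, ∀ c : ℝ, 0 < c → ∃ z ∈ P ω, 0 < z.1 ∧ z.1 < c ∧ 0 < z.2 := by
  have h : ∀ᵐ ω ∂μ, ∀ k : ℕ, ¬ (P ω ∩ Set.Ioo 0 (1 / ((k : ℝ) + 1)) ×ˢ Set.Ioi 0 = ∅) := by
    refine ae_all_iff.2 fun k => ?_
    rw [ae_iff]
    simp only [not_not]
    -- the strip has infinite mass, and is exhausted by rectangles of finite mass
    set c : ℝ := 1 / ((k : ℝ) + 1) with hc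
    have hc0 : 0 < c := by positivity
    have hle : ∀ m : ℕ, μ {ω | P ω ∩ Set.Ioo 0 c ×ˢ Set.Ioi 0 = ∅} ≤
        ENNReal.ofReal (Real.exp (-(c / 2 * m))) := by
      intro m
      have hvol : halfVolume (Set.Ioo 0 c ×ˢ Set.Ioo 0 (m : ℝ)) = ENNReal.ofReal (c / 2 * m) := by
        rw [halfVolume_apply, Measure.volume_eq_prod, Measure.prod_prod, Real.volume_Ioo,
          Real.volume_Ioo, inv_two_eq_ofReal, ← ENNReal.ofReal_mul (by linarith),
          ← ENNReal.ofReal_mul (by norm_num)]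
        congr 1
        ring
      have := hP.measure_inter_eq_empty (A := Set.Ioo 0 c ×ˢ Set.Ioo 0 (m : ℝ))
        (measurableSet_Ioo.prod measurableSet_Ioo) (by rw [hvol]; exact ENNReal.ofReal_ne_top)
      rw [hvol, ENNReal.toReal_ofReal (by positivity)] at this
      rw [← this]
      refine measure_mono fun ω hω => ?_
      refine Set.eq_empty_of_subset_empty fun z hz => ?_
      have : z ∈ P ω ∩ Set.Ioo 0 c ×ˢ Set.Ioi 0 := ⟨hz.1, hz.2.1, hz.2.2.1⟩
      rw [show P ω ∩ Set.Ioo 0 c ×ˢ Set.Ioi 0 = ∅ from hω] at this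
      exact this
    have hlim : Tendsto (fun m : ℕ => ENNReal.ofReal (Real.exp (-(c / 2 * m)))) atTop (𝓝 0) := by
      rw [← ENNReal.ofReal_zero]
      refine (ENNReal.continuous_ofReal.tendsto 0).comp ?_
      exact Real.tendsto_exp_neg_atTop_nhds_zero.comp
        (tendsto_natCast_atTop_atTop.const_mul_atTop (half_pos hc0))
    exact le_antisymm (ge_of_tendsto' hlim hle) bot_le
  filter_upwards [h] with ω hω c hc
  obtain ⟨k, hk⟩ := exists_nat_one_div_lt hc
  obtain ⟨z, hz, hz1, hz2⟩ := Set.nonempty_iff_ne_empty.2 (hω k)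
  exact ⟨z, hz, hz1.1, hz1.2.trans hk, hz2⟩

theorem IsPoissonProcess.ae_exists_isHullChain (hP : IsPoissonProcess P halfVolume μ) :
    ∀ᵐ ω ∂μ, ∃ x, IsHullChain (P ω) x := by
  filter_upwards [hP.ae_finite_triangle, hP.ae_exists_fst_lt] with ω h1 h2
  exact exists_isHullChain h1 h2

end Chain

/-! ### The law of the first vertex -/

/-- The density of the first vertex. -/
def firstDensity (z : ℝ × ℝ) : ℝ≥0∞ :=
  if 0 < z.1 ∧ 0 < z.2 then ENNReal.ofReal (1 / 2 * Real.exp (-((z.1 + z.2) ^ 2 / 4))) else 0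

theorem measurable_firstDensity : Measurable firstDensity := by
  unfold firstDensity
  refine Measurable.ite ?_ (by fun_prop) measurable_const
  exact (measurableSet_lt (by fun_prop) (by fun_prop) :
    MeasurableSet {z : ℝ × ℝ | 0 < z.1}).inter (measurableSet_lt measurable_const measurable_snd)

/-- The law of the first vertex. -/
def firstLaw : Measure (ℝ × ℝ) := volume.withDensity firstDensity

theorem pathMeasure_zero {A : Set (ℝ × ℝ)} (hA : MeasurableSet A) :
    pathMeasure 0 {v | extend v 0 ∈ A} = firstLaw A := by
  have hS : MeasurableSet {v : Fin 1 → ℝ × ℝ | extend v 0 ∈ A} :=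
    (continuous_extend 0).measurable hA
  rw [pathMeasure, firstLaw, withDensity_apply _ hS, withDensity_apply _ hA,
    ← lintegral_indicator hS, ← lintegral_indicator hA,
    ← (volume_preserving_funUnique (Fin 1) (ℝ × ℝ)).lintegral_comp
      (measurable_firstDensity.indicator hA)]
  refine lintegral_congr fun v => ?_
  have e0 : extend v 0 = v 0 := extend_self v
  have e1 : MeasurableEquiv.funUnique (Fin 1) (ℝ × ℝ) v = v 0 := rfl
  rw [e1]
  have h : pathDensity 0 v = firstDensity (v 0) := by
    by_cases hv : 0 < (v 0).1 ∧ 0 < (v 0).2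
    · rw [pathDensity_of_admissible ⟨e0 ▸ hv.1, e0 ▸ hv.2, by simp⟩, firstDensity, if_pos hv]
      simp [totalRate, rate, e0]
    · rw [pathDensity_of_not_admissible fun h => hv ⟨e0 ▸ h.1, e0 ▸ h.2.1⟩, firstDensity,
        if_neg hv]
  have hmem : v ∈ {v : Fin 1 → ℝ × ℝ | extend v 0 ∈ A} ↔ v 0 ∈ A := by
    rw [Set.mem_ofPred_eq, e0]
  by_cases hv : v 0 ∈ A
  · rw [Set.indicator_of_mem (hmem.2 hv), Set.indicator_of_mem hv, h]
  · rw [Set.indicator_of_notMem (mt hmem.1 hv), Set.indicator_of_notMem hv]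

theorem lintegral_half_mul_exp :
    ∫⁻ h in Set.Ioi (0 : ℝ), ENNReal.ofReal (h / 2 * Real.exp (-(h ^ 2 / 4))) = 1 := by
  have hd : ∀ h ∈ Set.Ici (0 : ℝ), HasDerivAt (fun h : ℝ => -Real.exp (-(h ^ 2 / 4)))
      (h / 2 * Real.exp (-(h ^ 2 / 4))) h := by
    intro h _
    have h1 := ((((hasDerivAt_id h).pow 2).div_const 4).neg.exp).neg
    convert! h1 using 1
    simp
    ring
  have hpos : ∀ h ∈ Set.Ioi (0 : ℝ), 0 ≤ h / 2 * Real.exp (-(h ^ 2 / 4)) := fun h hh =>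
    mul_nonneg (div_nonneg (le_of_lt hh) two_pos.le) (Real.exp_pos _).le
  have hlim : Tendsto (fun h : ℝ => -Real.exp (-(h ^ 2 / 4))) atTop (𝓝 0) := by
    rw [← neg_zero]
    refine (Real.tendsto_exp_neg_atTop_nhds_zero.comp ?_).neg
    exact (tendsto_pow_atTop two_ne_zero).atTop_div_const (by norm_num)
  rw [← ofReal_integral_eq_lintegral_ofReal (integrableOn_Ioi_deriv_of_nonneg' hd hpos hlim)
    ((ae_restrict_iff' measurableSet_Ioi).2 (Eventually.of_forall hpos)),
    integral_Ioi_of_hasDerivAt_of_nonneg' hd hpos hlim]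
  simp

instance isProbabilityMeasure_firstLaw : IsProbabilityMeasure firstLaw := by
  constructor
  rw [firstLaw, withDensity_apply _ MeasurableSet.univ, Measure.restrict_univ,
    Measure.volume_eq_prod, lintegral_prod _ measurable_firstDensity.aemeasurable]
  -- the height `h = b + a` at abscissa `1` replaces the slope as a coordinate
  let G : ℝ → ℝ → ℝ≥0∞ := fun b h =>
    if 0 < b ∧ b < h then ENNReal.ofReal (1 / 2 * Real.exp (-(h ^ 2 / 4))) else 0
  have hG : Measurable (Function.uncurry G) := by
    simp only [G, Function.uncurry_def]
    refine Measurable.ite ?_ (by fun_prop) measurable_const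
    exact (measurableSet_lt (by fun_prop) (by fun_prop) :
      MeasurableSet {z : ℝ × ℝ | 0 < z.1}).inter (measurableSet_lt measurable_fst measurable_snd)
  have e1 : ∀ b, ∫⁻ a, firstDensity (b, a) = ∫⁻ h, G b h := by
    intro b
    rw [← lintegral_add_left_eq_self (G b) b]
    refine lintegral_congr fun a => ?_
    simp only [firstDensity, G, lt_add_iff_pos_right]
  simp only [e1]
  rw [lintegral_lintegral_swap hG.aemeasurable, ← lintegral_half_mul_exp,
    ← lintegral_indicator measurableSet_Ioi]
  refine lintegral_congr fun h => ?_
  have e2 : ∀ b, G b h = (Set.Ioo 0 h).indicator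
      (fun _ => ENNReal.ofReal (1 / 2 * Real.exp (-(h ^ 2 / 4)))) b := fun b => by
    simp only [G, Set.indicator, Set.mem_Ioo]
  simp only [e2]
  rw [lintegral_indicator measurableSet_Ioo, setLIntegral_const, Real.volume_Ioo, sub_zero,
    ← ENNReal.ofReal_mul (by positivity)]
  by_cases hh : 0 < h
  · rw [Set.indicator_of_mem (Set.mem_Ioi.2 hh)]
    congr 1
    ring
  · rw [Set.indicator_of_notMem (by simpa using hh), ENNReal.ofReal_eq_zero]
    exact mul_nonpos_of_nonneg_of_nonpos (by positivity) (not_lt.1 hh)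

theorem integrable_fst_firstLaw : Integrable (fun z : ℝ × ℝ => z.1) firstLaw := by
  refine ⟨by fun_prop, ?_⟩
  rw [HasFiniteIntegral, firstLaw, lintegral_withDensity_eq_lintegral_mul _
    measurable_firstDensity (by fun_prop)]
  have h1 : Integrable (fun b : ℝ => b * Real.exp (-(1 / 4) * b ^ 2)) :=
    integrable_mul_exp_neg_mul_sq (by norm_num)
  have h2 : Integrable (fun a : ℝ => Real.exp (-(1 / 4) * a ^ 2)) :=
    integrable_exp_neg_mul_sq (by norm_num)
  refine lt_of_le_of_lt (lintegral_mono fun z => ?_) (h1.mul_prod h2).lintegral_lt_top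
  simp only [Pi.mul_apply, firstDensity]
  split_ifs with hz
  · rw [Real.enorm_eq_ofReal hz.1.le, ← ENNReal.ofReal_mul (by positivity)]
    refine ENNReal.ofReal_le_ofReal ?_
    rw [mul_assoc z.1, ← Real.exp_add]
    have : Real.exp (-((z.1 + z.2) ^ 2 / 4)) ≤
        Real.exp (-(1 / 4) * z.1 ^ 2 + -(1 / 4) * z.2 ^ 2) :=
      Real.exp_le_exp.2 (by nlinarith [mul_pos hz.1 hz.2])
    nlinarith [mul_le_mul_of_nonneg_left this hz.1.le, Real.exp_pos (-((z.1 + z.2) ^ 2 / 4)),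
      mul_pos hz.1 (Real.exp_pos (-((z.1 + z.2) ^ 2 / 4)))]
  · simp

/-! ### The joint law of the area fractions -/

theorem measurableSet_fractions (n : ℕ) {A₀ : Set (ℝ × ℝ)} (hA₀ : MeasurableSet A₀)
    {A : ℕ → Set ℝ} (hA : ∀ i, MeasurableSet (A i)) :
    MeasurableSet {v : Fin (n + 1) → ℝ × ℝ | extend v 0 ∈ A₀ ∧
      ∀ i < n, areaFraction (extend v i) (extend v (i + 1)) ∈ A i} := by
  have e : {v : Fin (n + 1) → ℝ × ℝ | extend v 0 ∈ A₀ ∧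
      ∀ i < n, areaFraction (extend v i) (extend v (i + 1)) ∈ A i} =
      (fun v => extend v 0) ⁻¹' A₀ ∩
        ⋂ i ∈ Finset.range n, (fun v => areaFraction (extend v i) (extend v (i + 1))) ⁻¹' A i := by
    ext v
    simp
  rw [e]
  refine ((continuous_extend 0).measurable hA₀).inter
    (Finset.measurableSet_biInter _ fun i _ => ?_)
  have h1 := (continuous_extend (n := n) i).measurable
  have h2 := (continuous_extend (n := n) (i + 1)).measurable
  have : Measurable fun v : Fin (n + 1) → ℝ × ℝ =>
      areaFraction (extend v i) (extend v (i + 1)) := by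
    unfold areaFraction
    fun_prop
  exact this (hA i)

theorem pathMeasure_fractions (n : ℕ) {A₀ : Set (ℝ × ℝ)} (hA₀ : MeasurableSet A₀)
    {A : ℕ → Set ℝ} (hA : ∀ i, MeasurableSet (A i)) :
    pathMeasure n {v | extend v 0 ∈ A₀ ∧
      ∀ i < n, areaFraction (extend v i) (extend v (i + 1)) ∈ A i} =
      firstLaw A₀ * ∏ i ∈ Finset.range n, volume (A i ∩ Set.Icc 0 1) := by
  induction n with
  | zero => simpa using pathMeasure_zero hA₀
  | succ n ih =>
    have hB := measurableSet_fractions n hA₀ hA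
    rw [Finset.prod_range_succ, ← mul_assoc, ← ih, ← pathMeasure_succ n hB (hA n)]
    congr 1
    ext v
    have e1 : extend v n = Fin.init v (Fin.last n) := by rw [extend_init v le_rfl, extend_self]
    have e2 : extend v (n + 1) = v (Fin.last (n + 1)) := extend_self v
    have e3 : ∀ i < n, (areaFraction (extend v i) (extend v (i + 1)) ∈ A i ↔
        areaFraction (extend (Fin.init v) i) (extend (Fin.init v) (i + 1)) ∈ A i) := fun i hi => by
      rw [extend_init v (by omega), extend_init v (by omega)]
    simp only [Set.mem_ofPred_eq, ← e1, ← e2, ← extend_init v (Nat.zero_le n)]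
    constructor
    · rintro ⟨h1, h2⟩
      exact ⟨⟨h1, fun i hi => (e3 i hi).1 (h2 i (by omega))⟩, h2 n (by omega)⟩
    · rintro ⟨⟨h1, h2⟩, h3⟩
      refine ⟨h1, fun i hi => ?_⟩
      rcases Nat.lt_succ_iff_lt_or_eq.1 hi with hi | rfl
      · exact (e3 i hi).2 (h2 i hi)
      · exact h3

instance isProbabilityMeasure_pathMeasure (n : ℕ) : IsProbabilityMeasure (pathMeasure n) := by
  constructor
  simpa using pathMeasure_fractions n MeasurableSet.univ (A := fun _ => Set.univ)
    (fun _ => MeasurableSet.univ)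

section Law

variable {Ω : Type*} [MeasurableSpace Ω] {μ : Measure Ω} [IsProbabilityMeasure μ]
  {P : Ω → Set (ℝ × ℝ)} {X : Ω → ℕ → ℝ × ℝ}

theorem IsPoissonProcess.aemeasurable_vertex (hP : IsPoissonProcess P halfVolume μ)
    (hX : ∀ᵐ ω ∂μ, IsHullChain (P ω) (X ω)) (n : ℕ) : AEMeasurable (fun ω => X ω n) μ := by
  have h := (nullMeasurable_of_measure_preimage_le (μ := μ) (m := pathMeasure n)
    (f := fun ω (i : Fin (n + 1)) => X ω i) fun s _ => hP.measure_path_le hX n s).1.aemeasurable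
  exact (measurable_pi_apply (Fin.last n)).comp_aemeasurable h

theorem IsPoissonProcess.measure_fractions (hP : IsPoissonProcess P halfVolume μ)
    (hX : ∀ᵐ ω ∂μ, IsHullChain (P ω) (X ω)) (n : ℕ) {A₀ : Set (ℝ × ℝ)} (hA₀ : MeasurableSet A₀)
    {A : ℕ → Set ℝ} (hA : ∀ i, MeasurableSet (A i)) :
    μ {ω | X ω 0 ∈ A₀ ∧ ∀ i < n, areaFraction (X ω i) (X ω (i + 1)) ∈ A i} =
      firstLaw A₀ * ∏ i ∈ Finset.range n, volume (A i ∩ Set.Icc 0 1) := by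
  have h := (nullMeasurable_of_measure_preimage_le (μ := μ) (m := pathMeasure n)
    (f := fun ω (i : Fin (n + 1)) => X ω i) fun s _ => hP.measure_path_le hX n s).2
  rw [← pathMeasure_fractions n hA₀ hA, ← h]
  · congr 1
    ext ω
    simp only [Set.mem_ofPred_eq, Set.mem_preimage]
    rw [extend_restrict (X ω) (Nat.zero_le n)]
    refine and_congr_right fun _ => forall₂_congr fun i hi => ?_
    rw [extend_restrict (X ω) hi.le, extend_restrict (X ω) hi]
  · exact measurableSet_fractions n hA₀ hA

end Law

/-! ### Independence of the fractions -/

/-- A first vertex `V` with law `firstLaw`, and fractions `U i` which are uniform on `[0, 1]`,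
independent of each other and of `V`. -/
structure IsFractionSequence {Ω : Type*} [MeasurableSpace Ω] (V : Ω → ℝ × ℝ) (U : ℕ → Ω → ℝ)
    (μ : Measure Ω) : Prop where
  measurable_start : Measurable V
  measurable_fraction : ∀ i, Measurable (U i)
  law : ∀ (n : ℕ) (A₀ : Set (ℝ × ℝ)), MeasurableSet A₀ → ∀ A : ℕ → Set ℝ,
    (∀ i, MeasurableSet (A i)) → μ {ω | V ω ∈ A₀ ∧ ∀ i < n, U i ω ∈ A i} =
      firstLaw A₀ * ∏ i ∈ Finset.range n, volume (A i ∩ Set.Icc 0 1)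

/-- The first vertex followed by the fractions, as one sequence of random points of the plane so
that independence of the whole can be stated for a single family. -/
def driver {Ω : Type*} (V : Ω → ℝ × ℝ) (U : ℕ → Ω → ℝ) : ℕ → Ω → ℝ × ℝ
  | 0 => V
  | n + 1 => fun ω => (U n ω, 0)

/-- The intercept of the `n`-th vertex, as a product of area fractions. -/
def intercept {Ω : Type*} (V : Ω → ℝ × ℝ) (U : ℕ → Ω → ℝ) (n : ℕ) (ω : Ω) : ℝ :=
  (V ω).1 * ∏ i ∈ Finset.range n, (1 - √(U i ω))

section

variable {Ω : Type*} {V : Ω → ℝ × ℝ} {U : ℕ → Ω → ℝ}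

theorem measurable_fraction_iSup {T : Set ℕ} {i : ℕ} (hi : i + 1 ∈ T) :
    Measurable[⨆ j ∈ T, MeasurableSpace.comap (driver V U j) inferInstance] (U i) := by
  have h1 : Measurable[MeasurableSpace.comap (driver V U (i + 1)) inferInstance]
      (driver V U (i + 1)) := comap_measurable _
  have h2 : Measurable[MeasurableSpace.comap (driver V U (i + 1)) inferInstance] (U i) :=
    measurable_fst.comp h1
  exact h2.mono (le_iSup₂ (f := fun j (_ : j ∈ T) =>
    MeasurableSpace.comap (driver V U j) inferInstance) (i + 1) hi) le_rfl

theorem measurable_start_iSup {T : Set ℕ} (h0 : 0 ∈ T) :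
    Measurable[⨆ j ∈ T, MeasurableSpace.comap (driver V U j) inferInstance] V := by
  have h1 : Measurable[MeasurableSpace.comap (driver V U 0) inferInstance] V := comap_measurable _
  exact h1.mono (le_iSup₂ (f := fun j (_ : j ∈ T) =>
    MeasurableSpace.comap (driver V U j) inferInstance) 0 h0) le_rfl

theorem intercept_succ (n : ℕ) (ω : Ω) :
    intercept V U (n + 1) ω = intercept V U n ω * (1 - √(U n ω)) := by
  rw [intercept, intercept, Finset.prod_range_succ, mul_assoc]

end

namespace IsFractionSequence

variable {Ω : Type*} [mΩ : MeasurableSpace Ω] {V : Ω → ℝ × ℝ} {U : ℕ → Ω → ℝ} {μ : Measure Ω}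

theorem measure_start (h : IsFractionSequence V U μ) {A : Set (ℝ × ℝ)} (hA : MeasurableSet A) :
    μ (V ⁻¹' A) = firstLaw A := by
  simpa [Set.preimage] using h.law 0 A hA (fun _ => Set.univ) fun _ => MeasurableSet.univ

theorem measure_fraction (h : IsFractionSequence V U μ) (i : ℕ) {A : Set ℝ}
    (hA : MeasurableSet A) : μ (U i ⁻¹' A) = volume (A ∩ Set.Icc 0 1) := by
  have := h.law (i + 1) Set.univ MeasurableSet.univ (fun j => if j = i then A else Set.univ)
    fun j => by split_ifs <;> [exact hA; exact MeasurableSet.univ]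
  rw [Finset.prod_range_succ, Finset.prod_eq_one fun j hj => by
    rw [if_neg (Finset.mem_range.1 hj).ne]; simp] at this
  simp only [measure_univ, one_mul, if_true] at this
  rw [← this]
  congr 1
  ext ω
  simp only [Set.mem_preimage, Set.mem_ofPred_eq, Set.mem_univ, true_and]
  constructor
  · intro hω j _
    split_ifs with hj
    · rw [hj]; exact hω
    · trivial
  · intro hω
    simpa using hω i (Nat.lt_succ_self i)

theorem hasLaw_start (h : IsFractionSequence V U μ) : HasLaw V firstLaw μ := by
  refine ⟨h.measurable_start.aemeasurable, Measure.ext fun s hs => ?_⟩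
  rw [Measure.map_apply h.measurable_start hs, h.measure_start hs]

theorem hasLaw_fraction (h : IsFractionSequence V U μ) (i : ℕ) :
    HasLaw (U i) (volume.restrict (Set.Icc (0 : ℝ) 1)) μ := by
  refine ⟨(h.measurable_fraction i).aemeasurable, Measure.ext fun s hs => ?_⟩
  rw [Measure.map_apply (h.measurable_fraction i) hs, h.measure_fraction i hs,
    Measure.restrict_apply hs]

theorem measurable_driver (h : IsFractionSequence V U μ) (i : ℕ) : Measurable (driver V U i) := by
  cases i with
  | zero => exact h.measurable_start
  | succ i => exact (h.measurable_fraction i).prodMk measurable_const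

theorem iIndepFun_driver (h : IsFractionSequence V U μ) : iIndepFun (driver V U) μ := by
  rw [iIndepFun_iff_measure_inter_preimage_eq_mul]
  intro S B hB
  classical
  have : IsProbabilityMeasure μ := by
    constructor
    simpa using h.measure_start MeasurableSet.univ
  obtain ⟨n, hn⟩ : ∃ n, S ⊆ Finset.range (n + 1) :=
    ⟨S.sup id, fun i hi => Finset.mem_range.2 (Nat.lt_succ_of_le (Finset.le_sup (f := id) hi))⟩
  let C : ℕ → Set (ℝ × ℝ) := fun i => if i ∈ S then B i else Set.univ
  have hC : ∀ i, MeasurableSet (C i) := fun i => by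
    by_cases hi : i ∈ S
    · simp only [C, hi, if_true]; exact hB i hi
    · simp [C, hi]
  have e1 : ⋂ i ∈ S, driver V U i ⁻¹' B i = {ω | V ω ∈ C 0 ∧ ∀ i < n, U i ω ∈
      (fun u : ℝ => (u, (0 : ℝ))) ⁻¹' C (i + 1)} := by
    ext ω
    simp only [Set.mem_iInter, Set.mem_preimage, Set.mem_ofPred_eq]
    constructor
    · intro hω
      have hω' : ∀ i, driver V U i ω ∈ C i := fun i => by
        by_cases hi : i ∈ S
        · simp only [C, hi, if_true]; exact hω i hi
        · simp [C, hi]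
      exact ⟨hω' 0, fun i _ => hω' (i + 1)⟩
    · rintro ⟨h0, h1⟩ i hi
      have hCi : C i = B i := if_pos hi
      rw [← hCi]
      cases i with
      | zero => exact h0
      | succ i => exact h1 i (by simpa using hn hi)
  have e2 : ∏ i ∈ S, μ (driver V U i ⁻¹' B i) =
      ∏ i ∈ Finset.range (n + 1), μ (driver V U i ⁻¹' C i) := by
    rw [← Finset.prod_subset hn]
    · refine Finset.prod_congr rfl fun i hi => ?_
      have hCi : C i = B i := if_pos hi
      rw [hCi]
    · intro i _ hi
      have hCi : C i = Set.univ := if_neg hi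
      rw [hCi, Set.preimage_univ, measure_univ]
  have hm : Measurable fun u : ℝ => (u, (0 : ℝ)) := by fun_prop
  rw [e1, e2, h.law n (C 0) (hC 0) _ fun i => hm (hC (i + 1)), Finset.prod_range_succ', mul_comm]
  congr 1
  · refine Finset.prod_congr rfl fun i _ => ?_
    rw [← h.measure_fraction i (hm (hC (i + 1)))]
    rfl
  · exact (h.measure_start (hC 0)).symm

theorem iIndepFun_fraction (h : IsFractionSequence V U μ) : iIndepFun U μ := by
  have e := (h.iIndepFun_driver.precomp (g := fun n => n + 1) (add_left_injective 1)).comp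
    (fun _ => (Prod.fst : ℝ × ℝ → ℝ)) fun _ => measurable_fst
  have hU : (fun i => Prod.fst ∘ driver V U (i + 1)) = U := rfl
  rwa [hU] at e

theorem indep_iSup (h : IsFractionSequence V U μ) {S T : Set ℕ} (hST : Disjoint S T) :
    Indep (⨆ j ∈ S, MeasurableSpace.comap (driver V U j) inferInstance)
      (⨆ j ∈ T, MeasurableSpace.comap (driver V U j) inferInstance) μ :=
  indep_iSup_of_disjoint (fun i => (h.measurable_driver i).comap_le) h.iIndepFun_driver.iIndep hST

theorem indepFun_start_fractions (h : IsFractionSequence V U μ) :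
    IndepFun V (fun ω n => U n ω) μ := by
  have hST : Disjoint ({0} : Set ℕ) {j | 0 < j} := by simp
  refine indep_of_indep_of_le (h.indep_iSup hST) ?_ ?_
  · exact (measurable_start_iSup (Set.mem_singleton 0)).comap_le
  · refine Measurable.comap_le ?_
    exact @measurable_pi_lambda _ _ _ (⨆ j ∈ {j | 0 < j}, _) _ _ fun i =>
      measurable_fraction_iSup (T := {j | 0 < j}) (Nat.succ_pos i)

/-! ### The martingale of the intercepts -/

theorem ae_mem_Icc (h : IsFractionSequence V U μ) : ∀ᵐ ω ∂μ, ∀ i, U i ω ∈ Set.Icc (0 : ℝ) 1 := by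
  refine ae_all_iff.2 fun i => ?_
  have := h.measure_fraction i (measurableSet_Icc (a := (0 : ℝ)) (b := 1)).compl
  rw [Set.compl_inter_self, measure_empty] at this
  exact this

theorem ae_fst_pos (h : IsFractionSequence V U μ) : ∀ᵐ ω ∂μ, 0 < (V ω).1 := by
  have hm : MeasurableSet {z : ℝ × ℝ | ¬ 0 < z.1} :=
    (measurableSet_lt measurable_const measurable_fst).compl
  have h1 := h.measure_start hm
  rw [firstLaw, withDensity_apply _ hm, setLIntegral_congr_fun hm (f := firstDensity)
    (g := fun _ => 0) fun z hz => if_neg fun hh => hz hh.1] at h1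
  rw [ae_iff]
  simpa using h1

theorem isProbabilityMeasure (h : IsFractionSequence V U μ) : IsProbabilityMeasure μ := by
  constructor
  simpa using h.measure_start MeasurableSet.univ

theorem measurable_intercept (h : IsFractionSequence V U μ) (n : ℕ) :
    Measurable (intercept V U n) := by
  have h1 := h.measurable_start
  have h2 := h.measurable_fraction
  unfold intercept
  fun_prop

theorem ae_intercept_nonneg (h : IsFractionSequence V U μ) :
    ∀ᵐ ω ∂μ, ∀ n, 0 ≤ intercept V U n ω ∧ intercept V U n ω ≤ (V ω).1 := by
  filter_upwards [h.ae_fst_pos, h.ae_mem_Icc] with ω h1 h2 n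
  have h3 : ∀ i, 0 ≤ 1 - √(U i ω) ∧ 1 - √(U i ω) ≤ 1 := fun i =>
    ⟨by linarith [Real.sqrt_le_one.2 (h2 i).2], by linarith [Real.sqrt_nonneg (U i ω)]⟩
  exact ⟨mul_nonneg h1.le (Finset.prod_nonneg fun i _ => (h3 i).1),
    mul_le_of_le_one_right h1.le (Finset.prod_le_one (fun i _ => (h3 i).1) fun i _ => (h3 i).2)⟩

theorem integrable_start (h : IsFractionSequence V U μ) : Integrable (fun ω => (V ω).1) μ := by
  have := integrable_fst_firstLaw
  rw [← h.hasLaw_start.map_eq] at this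
  exact this.comp_measurable h.measurable_start

theorem integrable_intercept (h : IsFractionSequence V U μ) (n : ℕ) :
    Integrable (intercept V U n) μ := by
  refine h.integrable_start.mono (h.measurable_intercept n).aestronglyMeasurable ?_
  filter_upwards [h.ae_intercept_nonneg] with ω hω
  rw [Real.norm_of_nonneg (hω n).1]
  exact (hω n).2.trans (le_abs_self _)

theorem setIntegral_one_sub_sqrt : ∫ x in Set.Icc (0 : ℝ) 1, (3 * (1 - √x)) = 1 := by
  rw [integral_Icc_eq_integral_Ioc, ← intervalIntegral.integral_of_le zero_le_one,
    intervalIntegral.integral_const_mul, intervalIntegral.integral_sub (by simp)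
      (Real.continuous_sqrt.intervalIntegrable _ _)]
  simp only [Real.sqrt_eq_rpow]
  rw [integral_rpow (Or.inl (by norm_num))]
  norm_num

theorem condExp_step {Ω : Type*} {m mΩ : MeasurableSpace Ω} {V : Ω → ℝ × ℝ} {U : ℕ → Ω → ℝ}
    {μ : Measure Ω} (h : IsFractionSequence V U μ) (n : ℕ)
    (hm : m ≤ mΩ) (hmn : m ≤ ⨆ j ∈ Set.Iic n, MeasurableSpace.comap (driver V U j) inferInstance) :
    μ[fun ω => 3 * (1 - √(U n ω)) | m] =ᵐ[μ] fun _ => 1 := by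
  have := h.isProbabilityMeasure
  have hST : Disjoint ({n + 1} : Set ℕ) (Set.Iic n) := by simp
  have hind := indep_of_indep_of_le_right (h.indep_iSup hST) hmn
  have hle : (⨆ j ∈ ({n + 1} : Set ℕ), MeasurableSpace.comap (driver V U j) inferInstance) ≤ mΩ :=
    iSup₂_le fun j _ => (h.measurable_driver j).comap_le
  have hU : Measurable[⨆ j ∈ ({n + 1} : Set ℕ), MeasurableSpace.comap (driver V U j)
      inferInstance] (U n) := measurable_fraction_iSup (Set.mem_singleton _)
  have hf : Measurable fun x : ℝ => 3 * (1 - √x) := by fun_prop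
  refine (condExp_indep_eq hle hm (hf.comp hU).stronglyMeasurable hind).trans ?_
  have := (h.hasLaw_fraction n).integral_comp (f := fun x : ℝ => 3 * (1 - √x))
    hf.aestronglyMeasurable
  rw [setIntegral_one_sub_sqrt] at this
  rw [this]

/-- The intercepts up to time `n` depend on the first vertex and the first `n` fractions only. -/
theorem natural_le (hY : ∀ n, StronglyMeasurable (intercept V U n)) (n : ℕ) :
    Filtration.natural (intercept V U) hY n ≤
      ⨆ j ∈ Set.Iic n, MeasurableSpace.comap (driver V U j) inferInstance := by
  refine iSup₂_le fun k hk => ?_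
  refine Measurable.comap_le ?_
  have h1 : Measurable[⨆ j ∈ Set.Iic n, MeasurableSpace.comap (driver V U j) inferInstance] V :=
    measurable_start_iSup (Set.mem_Iic.2 (Nat.zero_le n))
  have h2 : ∀ i ∈ Finset.range k, Measurable[⨆ j ∈ Set.Iic n,
      MeasurableSpace.comap (driver V U j) inferInstance] fun ω => 1 - √(U i ω) := by
    intro i hi
    have h3 : Measurable[⨆ j ∈ Set.Iic n, MeasurableSpace.comap (driver V U j) inferInstance]
        (U i) := measurable_fraction_iSup (Set.mem_Iic.2 (by
      have := Finset.mem_range.1 hi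
      omega))
    exact (by fun_prop : Measurable fun x : ℝ => 1 - √x).comp h3
  exact (measurable_fst.comp h1).mul (Finset.measurable_fun_prod _ h2)

theorem martingale_intercept (h : IsFractionSequence V U μ)
    (hY : ∀ n, StronglyMeasurable (intercept V U n)) :
    Martingale (fun n ω => 3 ^ n * intercept V U n ω)
      (Filtration.natural (intercept V U) hY) μ := by
  have := h.isProbabilityMeasure
  have hadp : StronglyAdapted (Filtration.natural (intercept V U) hY)
      (fun n ω => (3 : ℝ) ^ n * intercept V U n ω) := fun n =>
    (Filtration.stronglyAdapted_natural hY n).const_mul _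
  have hint : ∀ n, Integrable (fun ω => (3 : ℝ) ^ n * intercept V U n ω) μ := fun n =>
    (h.integrable_intercept n).const_mul _
  refine martingale_nat hadp hint fun n => ?_
  have e : (fun ω => (3 : ℝ) ^ (n + 1) * intercept V U (n + 1) ω) =
      (fun ω => (3 : ℝ) ^ n * intercept V U n ω) * fun ω => 3 * (1 - √(U n ω)) := by
    funext ω
    simp only [Pi.mul_apply, intercept_succ]
    ring
  have hUint : Integrable (fun ω => 3 * (1 - √(U n ω))) μ := by
    have hmeas : Measurable fun ω => 3 * (1 - √(U n ω)) := by
      have := h.measurable_fraction n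
      fun_prop
    refine Integrable.of_bound hmeas.aestronglyMeasurable 3 ?_
    filter_upwards [h.ae_mem_Icc] with ω hω
    rw [Real.norm_of_nonneg] <;>
      linarith [Real.sqrt_le_one.2 (hω n).2, Real.sqrt_nonneg (U n ω)]
  rw [e]
  have h1 := condExp_mul_of_stronglyMeasurable_left (μ := μ) (hadp n) (e ▸ hint (n + 1)) hUint
  filter_upwards [h1, h.condExp_step n (Filtration.le _ n) (natural_le hY n)] with ω h1 h2
  rw [h1, Pi.mul_apply, h2, mul_one]

theorem ae_tendsto (h : IsFractionSequence V U μ) :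
    ∃ Z : Ω → ℝ, Measurable Z ∧ (∀ ω, 0 ≤ Z ω) ∧
      ∀ᵐ ω ∂μ, Tendsto (fun n => 3 ^ n * intercept V U n ω) atTop (𝓝 (Z ω)) := by
  have := h.isProbabilityMeasure
  have hY : ∀ n, StronglyMeasurable (intercept V U n) := fun n =>
    (h.measurable_intercept n).stronglyMeasurable
  have hM := h.martingale_intercept hY
  have hbdd : ∀ n, eLpNorm (fun ω => 3 ^ n * intercept V U n ω) 1 μ ≤
      (∫ ω, intercept V U 0 ω ∂μ).toNNReal := by
    intro n
    have hi := (h.integrable_intercept n).const_mul ((3 : ℝ) ^ n)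
    rw [eLpNorm_one_eq_lintegral_enorm, ← ofReal_integral_norm_eq_lintegral_enorm hi]
    refine ENNReal.ofReal_le_ofReal (le_of_eq ?_)
    have e1 : ∫ ω, ‖3 ^ n * intercept V U n ω‖ ∂μ = ∫ ω, 3 ^ n * intercept V U n ω ∂μ := by
      refine integral_congr_ae ?_
      filter_upwards [h.ae_intercept_nonneg] with ω hω
      exact Real.norm_of_nonneg (mul_nonneg (by positivity) (hω n).1)
    have e2 := hM.setIntegral_eq (Nat.zero_le n) MeasurableSet.univ
    simp only [Measure.restrict_univ, pow_zero, one_mul] at e2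
    rw [e1, ← e2]
  obtain ⟨G, hG, hlim⟩ := measurable_limit_of_tendsto_metrizable_ae (μ := μ) (L := atTop)
    (f := fun n ω => 3 ^ n * intercept V U n ω)
    (fun n => ((h.measurable_intercept n).const_mul _).aemeasurable)
    ((hM.submartingale.ae_tendsto_limitProcess hbdd).mono fun ω hω => ⟨_, hω⟩)
  refine ⟨fun ω => max 0 (G ω), measurable_const.max hG, fun ω => le_max_left _ _, ?_⟩
  filter_upwards [hlim, h.ae_intercept_nonneg] with ω h1 h2
  rwa [max_eq_right (ge_of_tendsto' h1 fun n => mul_nonneg (by positivity) (h2 n).1)]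

end IsFractionSequence

/-! ### The perpetuity of the Poisson process -/

theorem exists_isFractionSequence {Ω : Type*} [MeasurableSpace Ω] {μ : Measure Ω}
    [IsProbabilityMeasure μ] {P : Ω → Set (ℝ × ℝ)} {X : Ω → ℕ → ℝ × ℝ}
    (hP : IsPoissonProcess P halfVolume μ) (hX : ∀ᵐ ω ∂μ, IsHullChain (P ω) (X ω)) :
    ∃ (V : Ω → ℝ × ℝ) (U : ℕ → Ω → ℝ), IsFractionSequence V U μ ∧ (∀ᵐ ω ∂μ, V ω = X ω 0) ∧
      ∀ᵐ ω ∂μ, ∀ n, U n ω = areaFraction (X ω n) (X ω (n + 1)) := by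
  have h0 := hP.aemeasurable_vertex hX
  have h1 : ∀ n, AEMeasurable (fun ω => areaFraction (X ω n) (X ω (n + 1))) μ := fun n => by
    have := h0 n
    have := h0 (n + 1)
    unfold areaFraction
    fun_prop
  have e0 : ∀ᵐ ω ∂μ, (h0 0).mk _ ω = X ω 0 := (h0 0).ae_eq_mk.symm
  have e1 : ∀ᵐ ω ∂μ, ∀ n, (h1 n).mk _ ω = areaFraction (X ω n) (X ω (n + 1)) :=
    ae_all_iff.2 fun n => (h1 n).ae_eq_mk.symm
  refine ⟨(h0 0).mk _, fun n => (h1 n).mk _, ⟨(h0 0).measurable_mk,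
    fun n => (h1 n).measurable_mk, fun n A₀ hA₀ A hA => ?_⟩, e0, e1⟩
  rw [← hP.measure_fractions hX n hA₀ hA]
  refine measure_congr ?_
  filter_upwards [e0, e1] with ω h0 h1
  refine propext ?_
  change (_ ∧ _) ↔ (_ ∧ _)
  simp only [h0, h1]

theorem areaFraction_sqrt {p q : ℝ × ℝ} (hp : 0 < p.1) (hq : q.1 < p.1) :
    √(areaFraction p q) = (p.1 - q.1) / p.1 :=
  Real.sqrt_sq (div_nonneg (sub_nonneg.2 hq.le) hp.le)

namespace IsHullChain

variable {L : Set Line} {x : ℕ → ℝ × ℝ} {P : Set (ℝ × ℝ)}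

theorem fst_succ (h : IsHullChain P x) (n : ℕ) :
    (x (n + 1)).1 = (x n).1 * (1 - √(areaFraction (x n) (x (n + 1)))) := by
  have := (h.fst_pos n).ne'
  rw [areaFraction_sqrt (h.fst_pos n) (h.fst_lt n)]
  field_simp
  ring

theorem snd_succ (h : IsHullChain (toPlane '' L) x) (n : ℕ) :
    (x (n + 1)).2 = (x n).2 +
      (x n).1 / changeTime L (n + 1) * √(areaFraction (x n) (x (n + 1))) := by
  have h0 := (h.fst_pos n).ne'
  have h1 := hitTime_mul x n (h.fst_lt n)
  have h2 : (x n).1 / (1 / hitTime x (n + 1)) * (((x n).1 - (x (n + 1)).1) / (x n).1) =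
      hitTime x (n + 1) * ((x n).1 - (x (n + 1)).1) := by
    rw [div_div_eq_mul_div, div_one]
    field_simp
  rw [h.changeTime_eq, areaFraction_sqrt (h.fst_pos n) (h.fst_lt n), h2, h1]
  ring

end IsHullChain

end PoissonCity

end

theorem corollary4p3 {Ω : Type*} [MeasurableSpace Ω] (μ : Measure Ω) [IsProbabilityMeasure μ]
    (L : Ω → Set PoissonCity.Line)
    (hL : PoissonCity.IsPoissonProcess L PoissonCity.lineIntensity μ)
    (S Y : ℕ → Ω → ℝ)
    (hS : ∀ n ω, S n ω = PoissonCity.changeTime (L ω) n)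
    (hY : ∀ n ω, Y n ω = PoissonCity.yIntercept (L ω) n) :
    -- the change times and the intercepts are non-degenerate
    (∀ᵐ ω ∂μ, ∀ n, 0 < S (n + 1) ω ∧ S (n + 1) ω < S n ω ∧ 0 < Y n ω) ∧
    -- the uniform variables that drive the slopes, and the perpetuity equation
    (∃ U : ℕ → Ω → ℝ,
      (∀ n, Measurable (U n)) ∧
      (∀ n, HasLaw (U (n + 1)) (volume.restrict (Set.Icc (0 : ℝ) 1)) μ) ∧
      iIndepFun (fun n => U (n + 1)) μ ∧
      IndepFun (fun ω => (PoissonCity.seminal (L ω) 1, PoissonCity.seminalSlope (L ω) 1))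
        (fun ω n => U (n + 1) ω) μ ∧
      (∀ᵐ ω ∂μ, ∀ n,
        PoissonCity.seminalSlope (L ω) (S (n + 1) ω) =
          PoissonCity.seminalSlope (L ω) (S n ω) +
            Y n ω / S (n + 1) ω * Real.sqrt (U (n + 1) ω)) ∧
      (∀ᵐ ω ∂μ, ∀ n,
        Y (n + 1) ω = Y n ω * (1 - Real.sqrt (U (n + 1) ω)) ∧
        Y (n + 1) ω = Y 0 ω * ∏ m ∈ Finset.Icc 1 (n + 1), (1 - Real.sqrt (U m ω)))) ∧
    -- up to modification on null sets, `3 ^ n * Y n` is a martingale in the filtration of `Y`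
    (∃ (Y' : ℕ → Ω → ℝ) (hY' : ∀ n, StronglyMeasurable (Y' n)),
      (∀ n, Y' n =ᵐ[μ] Y n) ∧
      Martingale (fun n ω => 3 ^ n * Y' n ω) (Filtration.natural Y' hY') μ) ∧
    -- the limsup is a finite random variable
    (∃ Z : Ω → ℝ, Measurable Z ∧ (∀ ω, 0 ≤ Z ω) ∧
      ∀ᵐ ω ∂μ, limsup (fun n => ((3 ^ n * Y n ω : ℝ) : EReal)) atTop = (Z ω : EReal)) ∧
    -- almost sure geometric convergence to zero
    (∀ᵐ ω ∂μ, Tendsto (fun n => Y n ω) atTop (nhds 0) ∧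
      ∃ C : ℝ, ∀ n, |Y n ω| ≤ C * (1 / 3) ^ n) := by
  have hP : PoissonCity.IsPoissonProcess (fun ω => PoissonCity.toPlane '' L ω)
      PoissonCity.halfVolume μ := PoissonCity.isPoissonProcess_toPlane hL
  -- the chain is chosen for each `ω` without regard to measurability, which holds a posteriori
  obtain ⟨X, hX⟩ : ∃ X : Ω → ℕ → ℝ × ℝ, ∀ᵐ ω ∂μ,
      PoissonCity.IsHullChain (PoissonCity.toPlane '' L ω) (X ω) := by
    classical
    refine ⟨fun ω => if h : ∃ x, PoissonCity.IsHullChain (PoissonCity.toPlane '' L ω) x then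
      h.choose else 0, ?_⟩
    filter_upwards [hP.ae_exists_isHullChain] with ω hω
    rw [dif_pos hω]
    exact hω.choose_spec
  obtain ⟨V, U, hVU, hV, hU⟩ := PoissonCity.exists_isFractionSequence hP hX
  have hYX : ∀ᵐ ω ∂μ, ∀ n, Y n ω = (X ω n).1 := by
    filter_upwards [hX] with ω hω n
    rw [hY, hω.yIntercept_eq]
  have hint : ∀ᵐ ω ∂μ, ∀ n, PoissonCity.intercept V U n ω = Y n ω := by
    filter_upwards [hX, hYX, hV, hU] with ω hω h1 h2 h3 n
    induction n with
    | zero => simp [PoissonCity.intercept, h1, h2]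
    | succ n ih => rw [PoissonCity.intercept_succ, ih, h1, h1, h3, ← hω.fst_succ]
  obtain ⟨Z, hZ, hZ0, hlim⟩ := hVU.ae_tendsto
  have hlimY : ∀ᵐ ω ∂μ, Tendsto (fun n => 3 ^ n * Y n ω) atTop (nhds (Z ω)) := by
    filter_upwards [hlim, hint] with ω h1 h2
    simpa only [h2] using h1
  refine ⟨?_, ⟨fun n => n.casesOn 0 U, ?_, hVU.hasLaw_fraction, hVU.iIndepFun_fraction, ?_, ?_,
    ?_⟩, ⟨PoissonCity.intercept V U, fun n => (hVU.measurable_intercept n).stronglyMeasurable,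
      fun n => ?_, hVU.martingale_intercept _⟩, ⟨Z, hZ, hZ0, ?_⟩, ?_⟩
  · filter_upwards [hX, hYX] with ω hω h1 n
    rw [hS, hS, hω.changeTime_eq, hω.changeTime_eq, h1]
    exact ⟨hω.inv_hitTime_pos _, hω.inv_hitTime_lt n, hω.fst_pos n⟩
  · intro n
    cases n with
    | zero => exact measurable_const
    | succ n => exact hVU.measurable_fraction n
  · have hφ : Measurable fun z : ℝ × ℝ => (z.1 + z.2, z.2) := by fun_prop
    refine (hVU.indepFun_start_fractions.comp hφ measurable_id).congr ?_ (ae_eq_refl _)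
    filter_upwards [hX, hV] with ω hω h1
    have e1 := hω.seminal_changeTime 0
    have e2 := hω.seminalSlope_changeTime 0
    simp only [PoissonCity.changeTime, mul_one] at e1 e2
    simp only [Function.comp_apply, h1, e1, e2]
  · filter_upwards [hX, hYX, hU] with ω hω h1 h2 n
    rw [hS, hS, hω.seminalSlope_changeTime, hω.seminalSlope_changeTime, h1]
    have h3 := hω.snd_succ n
    rw [← h2 n] at h3
    exact h3
  · filter_upwards [hint] with ω h1 n
    have hsucc : ∀ n, Y (n + 1) ω = Y n ω * (1 - √(U n ω)) := fun n => by
      rw [← h1, ← h1, PoissonCity.intercept_succ]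
    refine ⟨hsucc n, ?_⟩
    induction n with
    | zero => simp [hsucc]
    | succ n ih =>
      rw [Finset.prod_Icc_succ_top (by omega), ← mul_assoc, ← ih]
      exact hsucc (n + 1)
  · filter_upwards [hint] with ω h1 using h1 n
  · filter_upwards [hlimY] with ω h1
    exact ((continuous_coe_real_ereal.tendsto _).comp h1).limsup_eq
  · filter_upwards [hlimY, hX, hYX] with ω h1 hω h2
    obtain ⟨C, hC⟩ := h1.bddAbove_range
    have hle : ∀ n, |Y n ω| ≤ C * (1 / 3) ^ n := fun n => by
      have h3 : 0 < Y n ω := by rw [h2]; exact hω.fst_pos n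
      have h4 : 3 ^ n * Y n ω ≤ C := hC ⟨n, rfl⟩
      rw [abs_of_pos h3, one_div, inv_pow, ← div_eq_mul_inv, le_div_iff₀ (by positivity)]
      linarith
    refine ⟨squeeze_zero_norm hle ?_, C, hle⟩
    simpa using (tendsto_pow_atTop_nhds_zero_of_lt_one (r := (1 / 3 : ℝ)) (by norm_num)
      (by norm_num)).const_mul C
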